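/- Let $\delta>0$ be a real number and $r\ge 3$ an integer. There is $n_0=n_0(\delta,r)$ such that the following holds for every $n\ge n_0$, every $d\ge 1$, every graph $G$ on $V=[n]$ with all degrees at most $d$, every $R_0\subseteq V$, every integer $i$ with $5r^4\le i\le 1/\delta+3$, and every $s\in S_i$: with probability at least $n^{-4\delta r^4}$, the paths discovered by FindBiclique$(s)$ contain a $K_{r^2,r^2}$ minor. The notions are as follows. A random walk is the lazy random walk that moves from its current vertex to each neighbour with probability $1/(2d)$ and otherwise stays. Put $\ell=\lceil n^{5\delta}\rceil$. Strata. For $R\subseteq V$, $s,u\in R$ and $j\ge 0$, let $q^{(j)}_{[R],s}(u)$ be the probability that a random walk of length $2^j\ell$ from $s$ ends at $u$ and is in $R$ at each of its steps $\ell,2\ell,\dots,2^j\ell$. Starting with $R_0$, define for $i=0,1,2,\dots$ $$S_i=\Big\{s\in R_i:\ \sum_{u\in R_i} q^{(i+1)}_{[R_i],s}(u)^2\ge n^{-\delta i}\Big\},\qquad R_{i+1}=R_i\setminus S_i .$$ FindPath$(u,v,k,j)$ performs $k$ independent random walks of length $2^j\ell$ from $u$ and $k$ from $v$, and returns every pair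 consisting of one of the walks from $u$ and one of the walks from $v$ that end at the same vertex (each such pair forms a path from $u$ to $v$). FindBiclique$(s)$ performs, for each integer $j$ with $5r^4\le j\le 1/\delta+4$ and independently for different $j$, the following iteration: it performs $2r^2$ independent random walks of length $2^{j+1}\ell$ from $s$; the destinations of the first $r^2$ walks form the multiset $A$, and those of the others form the multiset $B$; then, for each $a\in A$ and $b\in B$ (counted with multiplicity), it runs FindPath$(a,b,\lceil n^{\delta(j+18)/2}\rceil,j)$ with fresh independent walks. If all these calls return a path, $F_j$ denotes the subgraph of $G$ formed by the edges of all returned paths. "The paths discovered contain a $K_{r^2,r^2}$ minor" means that in some iteration $j$ all calls of FindPath return a path and $F_j$ has $K_{r^2,r^2}$ as a minor. -/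

import Mathlib

namespace BicliqueMinor

noncomputable section

/-! ### Lazy random walks -/

/-- Transition probability of the lazy random walk on a graph of maximum degree at most `d`:
with probability `1/2` stay; otherwise draw a uniform index in `[d]` and move to the neighbour of
that index, staying put if the index exceeds the degree. Hence each neighbour is reached with
probability `1/(2d)`. -/
def lazyStep {n : ℕ} (G : SimpleGraph (Fin n)) [DecidableRel G.Adj] (d : ℕ) (u v : Fin n) : ℝ :=
  if u = v then 1 - (G.degree u : ℝ) / (2 * d)
  else if G.Adj u v then 1 / (2 * d) else 0

/-- A vertex sequence `w 0, w 1, …, w L` (a walk of length `L`, possibly with repetitions). -/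
abbrev Walk (n L : ℕ) : Type := Fin (L + 1) → Fin n

/-- The probability that the lazy random walk of length `L` from `u` is the sequence `w`. -/
def walkProb {n : ℕ} (G : SimpleGraph (Fin n)) [DecidableRel G.Adj] (d : ℕ) {L : ℕ}
    (u : Fin n) (w : Walk n L) : ℝ :=
  if w 0 = u then ∏ t : Fin L, lazyStep G d (w t.castSucc) (w t.succ) else 0

/-! ### Returning walks and stratification -/

/-- The basic walk length `ℓ = n^{5δ}`, rounded up. -/
def baseLength (n : ℕ) (δ : ℝ) : ℕ := ⌈(n : ℝ) ^ (5 * δ)⌉₊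

open Classical in
/-- The `R`-returning probability: the probability that a `2^i ℓ`-length random walk from `s` ends
at `u` and is in `R` at every `jℓ`-th step, `1 ≤ j ≤ 2^i`. -/
def returnProb {n : ℕ} (G : SimpleGraph (Fin n)) [DecidableRel G.Adj] (d l : ℕ)
    (R : Set (Fin n)) (i : ℕ) (s u : Fin n) : ℝ :=
  ∑ w : Walk n (2 ^ i * l),
    if w (Fin.last _) = u ∧ ∀ t : Fin (2 ^ i * l + 1), 0 < (t : ℕ) → l ∣ (t : ℕ) → w t ∈ R
    then walkProb G d s w else 0

open Classical in
/-- The squared Euclidean norm of the `R`-returning probability vector, indexed by `R`. -/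
def returnNormSq {n : ℕ} (G : SimpleGraph (Fin n)) [DecidableRel G.Adj] (d l : ℕ)
    (R : Set (Fin n)) (i : ℕ) (s : Fin n) : ℝ :=
  ∑ u : Fin n, if u ∈ R then returnProb G d l R i s u ^ 2 else 0

/-- The vertices of the residue `R` that are removed in phase `i`. -/
def peel {n : ℕ} (G : SimpleGraph (Fin n)) [DecidableRel G.Adj] (d : ℕ) (δ : ℝ)
    (R : Set (Fin n)) (i : ℕ) : Set (Fin n) :=
  {s | s ∈ R ∧ 1 / (n : ℝ) ^ (δ * i) ≤ returnNormSq G d (baseLength n δ) R (i + 1) s}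

/-- The residues: `R_0` is given and `R_{i+1} = R_i \ S_i`, that is, `R_i = R_0 \ ⋃_{j<i} S_j`. -/
def residue {n : ℕ} (G : SimpleGraph (Fin n)) [DecidableRel G.Adj] (d : ℕ) (δ : ℝ)
    (R₀ : Set (Fin n)) : ℕ → Set (Fin n)
  | 0 => R₀
  | i + 1 => residue G d δ R₀ i \ peel G d δ (residue G d δ R₀ i) i

/-- The `i`-th stratum `S_i`. -/
def stratum {n : ℕ} (G : SimpleGraph (Fin n)) [DecidableRel G.Adj] (d : ℕ) (δ : ℝ)
    (R₀ : Set (Fin n)) (i : ℕ) : Set (Fin n) :=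
  peel G d δ (residue G d δ R₀ i) i

/-! ### The procedure `FindPath` -/

/-- The randomness of one call `FindPath(u,v,k,i)`: `k` walks of length `L` from `u` and `k` walks
of length `L` from `v`. -/
abbrev PathSample (n k L : ℕ) : Type := (Fin k → Walk n L) × (Fin k → Walk n L)

/-- All `2k` walks are independent lazy random walks, from `u` and from `v` respectively. -/
def pathSampleProb {n : ℕ} (G : SimpleGraph (Fin n)) [DecidableRel G.Adj] (d : ℕ) {k L : ℕ}
    (u v : Fin n) (c : PathSample n k L) : ℝ :=
  (∏ m, walkProb G d u (c.1 m)) * ∏ m, walkProb G d v (c.2 m)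

/-- The paths returned by a call: all pairs, consisting of one of the walks from `u` and one of
the walks from `v`, that terminate at the same vertex. -/
def returnedPaths {n k L : ℕ} (c : PathSample n k L) : Set (Walk n L × Walk n L) :=
  {p | (∃ m, c.1 m = p.1) ∧ (∃ m, c.2 m = p.2) ∧ p.1 (Fin.last L) = p.2 (Fin.last L)}

/-! ### The procedure `FindBiclique` -/

/-- The number `k = n^{δ(i+18)/2}` of walks in each call of `FindPath`, rounded up. -/
def numWalks (n : ℕ) (δ : ℝ) (i : ℕ) : ℕ := ⌈(n : ℝ) ^ (δ * (i + 18) / 2)⌉₊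

/-- The randomness of one iteration of `FindBiclique`: the `N` walks whose destinations form `A`,
the `N` walks whose destinations form `B` (all of length `L'`), and a separate call of `FindPath`
for each pair in `A × B` (these are multisets, hence indexed by positions). -/
structure IterSample (n N L' k L : ℕ) : Type where
  walkA : Fin N → Walk n L'
  walkB : Fin N → Walk n L'
  call : Fin N → Fin N → PathSample n k L

/-- An iteration sample as a tuple. -/
def IterSample.equivProd (n N L' k L : ℕ) :
    (Fin N → Walk n L') × (Fin N → Walk n L') × (Fin N → Fin N → PathSample n k L) ≃
      IterSample n N L' k L where
  toFun p := ⟨p.1, p.2.1, p.2.2⟩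
  invFun x := (x.walkA, x.walkB, x.call)
  left_inv _ := rfl
  right_inv _ := rfl

instance (n N L' k L : ℕ) : Fintype (IterSample n N L' k L) :=
  @Fintype.ofEquiv _ _
    (@instFintypeProd _ _ Pi.instFintype (@instFintypeProd _ _ Pi.instFintype Pi.instFintype))
    (IterSample.equivProd n N L' k L)

theorem IterSample.sum_eq {n N L' k L : ℕ} (f : IterSample n N L' k L → ℝ) :
    ∑ x, f x = ∑ A : Fin N → Walk n L', ∑ B : Fin N → Walk n L',
      ∑ c : Fin N → Fin N → PathSample n k L, f ⟨A, B, c⟩ := by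
  let inst : Fintype ((Fin N → Walk n L') × (Fin N → Fin N → PathSample n k L)) :=
    @instFintypeProd _ _ Pi.instFintype Pi.instFintype
  let _ : Fintype ((Fin N → Walk n L') × (Fin N → Walk n L') ×
      (Fin N → Fin N → PathSample n k L)) := @instFintypeProd _ _ Pi.instFintype inst
  rw [← (IterSample.equivProd n N L' k L).sum_comp, Fintype.sum_prod_type]
  refine Finset.sum_congr rfl fun A _ => ?_
  rw [Fintype.sum_prod_type]
  rfl

/-- The vertex at position `a` of the multiset `A`. -/
def IterSample.vertA {n N L' k L : ℕ} (x : IterSample n N L' k L) (a : Fin N) : Fin n :=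
  x.walkA a (Fin.last L')

/-- The vertex at position `b` of the multiset `B`. -/
def IterSample.vertB {n N L' k L : ℕ} (x : IterSample n N L' k L) (b : Fin N) : Fin n :=
  x.walkB b (Fin.last L')

/-- The probability of an outcome of an iteration of `FindBiclique(s)`: independent walks
from `s` produce `A` and `B`, and given these the calls of `FindPath` are independent. -/
def iterProb {n N L' k L : ℕ} (G : SimpleGraph (Fin n)) [DecidableRel G.Adj] (d : ℕ)
    (s : Fin n) (x : IterSample n N L' k L) : ℝ :=
  (∏ a, walkProb G d s (x.walkA a)) * (∏ b, walkProb G d s (x.walkB b)) *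
    ∏ a, ∏ b, pathSampleProb G d (x.vertA a) (x.vertB b) (x.call a b)

/-- The graph formed by the (non-stationary) steps of a set of walks. -/
def walksGraph {n L : ℕ} (P : Set (Walk n L)) : SimpleGraph (Fin n) :=
  SimpleGraph.fromRel fun x y => ∃ w ∈ P, ∃ t : Fin L, w t.castSucc = x ∧ w t.succ = y

/-- The subgraph `F`: the collection of all paths returned by the calls of `FindPath`. -/
def IterSample.graph {n N L' k L : ℕ} (x : IterSample n N L' k L) : SimpleGraph (Fin n) :=
  walksGraph {w | ∃ a b, ∃ p ∈ returnedPaths (x.call a b), w = p.1 ∨ w = p.2}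

/-- `F` contains `H` as a minor: disjoint connected branch sets, with an edge of `F` between the
branch sets of adjacent vertices of `H`. -/
def HasMinor {V W : Type*} (F : SimpleGraph V) (H : SimpleGraph W) : Prop :=
  ∃ B : W → Set V, (∀ u, (F.induce (B u)).Connected) ∧
    (∀ u v, u ≠ v → Disjoint (B u) (B v)) ∧
    ∀ u v, H.Adj u v → ∃ x ∈ B u, ∃ y ∈ B v, F.Adj x y

/-- All calls of `FindPath` in the iteration return a path, and the collection of paths contains a
`K_{N,N}` minor. -/
def IterSample.Success {n N L' k L : ℕ} (x : IterSample n N L' k L) : Prop :=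
  (∀ a b, (returnedPaths (x.call a b)).Nonempty) ∧
    HasMinor x.graph (completeBipartiteGraph (Fin N) (Fin N))

/-- The iterations `i = 5r^4, …, 1/δ + 4` of `FindBiclique`. -/
abbrev loopRange (r : ℕ) (δ : ℝ) : Finset ℕ := Finset.Icc (5 * r ^ 4) ⌊1 / δ + 4⌋₊

/-- The randomness of `FindBiclique`, all iterations taken together. In iteration `j`, the
multisets `A` and `B` of size `r^2` come from walks of length `2^{j+1} ℓ`, and each call of
`FindPath` makes `n^{δ(j+18)/2}` walks of length `2^j ℓ` from each of its two vertices. -/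
abbrev RunSample (n r : ℕ) (δ : ℝ) : Type :=
  (j : loopRange r δ) → IterSample n (r ^ 2) (2 ^ ((j : ℕ) + 1) * baseLength n δ)
    (numWalks n δ j) (2 ^ (j : ℕ) * baseLength n δ)

/-- The probability of an outcome of `FindBiclique(s)`; the iterations are independent. -/
def runProb {n r : ℕ} {δ : ℝ} (G : SimpleGraph (Fin n)) [DecidableRel G.Adj] (d : ℕ)
    (s : Fin n) (x : RunSample n r δ) : ℝ :=
  ∏ j, iterProb G d s (x j)

open Classical in
/-- The probability that the paths discovered in `FindBiclique(s)` contain a `K_{r^2,r^2}` minor,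
that is, that the collection of paths found in one of its iterations does. -/
def findBicliqueProb {n : ℕ} (G : SimpleGraph (Fin n)) [DecidableRel G.Adj] (d r : ℕ) (δ : ℝ)
    (s : Fin n) : ℝ :=
  ∑ x : RunSample n r δ, if ∃ j, (x j).Success then runProb G d s x else 0

end

end BicliqueMinor

open BicliqueMinor

/-!
Only iteration `j = i` of the procedure is needed. Write `q` for the returning probabilities with
respect to `R = R_i`, at the scale given by the superscript, and `ν = n ^ δ`.

*Correlation.* On `R` the returning probabilities are the entries of powers of one symmetric
matrix (`returnProb_eq_pow`, `returnProb_comm`). Vertices of `R` survived all earlier phases, so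
`‖q^{(i)}_v‖² ≤ ν ^ (-(i-1))` for all `v ∈ R`, whereas `‖q^{(i+1)}_s‖² ≥ ν ^ (-i)`. Log-convexity of
moments (`returnNormSq_sq_le`) turns this into the statement that the end points `a`, `b` of two
walks of length `2 ^ (i+1) ℓ` from `s` have mean correlation `⟨q^{(i)}_a, q^{(i)}_b⟩` at least
`ν ^ (-(i+1))`. As no correlation exceeds `ν ^ (-(i-1))`, a pair is well correlated with
probability at least `ν ^ (-2) / 2` (`sq_le_sum_correlated`), and by Sidorenko's inequality
(`pow_le_sum_prod_prod`) all pairs in `A × B` are so simultaneously with probability at least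
`(ν ^ (-2) / 2) ^ (r ^ 4)`. Given this, each call of `FindPath` finds a pair of colliding returning
walks with probability at least `1/2`, by the second moment method (`half_le_collision`).

*Unwanted intersections.* The colliding walks form a biclique minor unless walks of different calls
with different origins in `A ⊔ B` meet (`hasMinor_completeBipartiteGraph`). A colliding pair costs a
factor `ν ^ (-(i-2))`, whatever the walk of the pair that is singled out. The walks singled out in
two calls continue two independent walks from `s`, which are spread out: no vertex has probability
more than `ν ^ (-(i-1))` for either of them, so they meet at given times with at most this
probability. Counting the choices of the walks and the times, the expected number of unwanted
intersections is at most about `ν ^ (51 - i)` (`sum_badCount_le`), which is negligible in comparison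
with `ν ^ (-3 r ^ 4)` since `i ≥ 5 r ^ 4` and `r ^ 4 ≥ 81` (`parameter_bound`).
-/

namespace BicliqueMinor

/-! ### Finite product weights -/

section ProductWeights

variable {ι : Type*} [Fintype ι] [DecidableEq ι]

theorem sum_pi_prod {C : ι → Type*} [∀ i, Fintype (C i)] (f : (i : ι) → C i → ℝ) :
    ∑ c : ((i : ι) → C i), ∏ i, f i (c i) = ∏ i, ∑ x, f i x := by
  rw [Finset.prod_univ_sum, Fintype.piFinset_univ]

theorem sum_pi_prod_eq_one {C : ι → Type*} [∀ i, Fintype (C i)] (f : (i : ι) → C i → ℝ)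
    (hf : ∀ i, ∑ x, f i x = 1) : ∑ c : ((i : ι) → C i), ∏ i, f i (c i) = 1 := by
  rw [sum_pi_prod]
  exact Finset.prod_eq_one fun i _ => hf i

theorem sum_pi_prod_mul {C : ι → Type*} [∀ i, Fintype (C i)] (ρ : (i : ι) → C i → ℝ)
    (hρ : ∀ i, ∑ x, ρ i x = 1) (i₀ : ι) (g : C i₀ → ℝ) :
    ∑ c : ((i : ι) → C i), (∏ i, ρ i (c i)) * g (c i₀) = ∑ x, ρ i₀ x * g x := by
  have h : ∀ c : ((i : ι) → C i), (∏ i, ρ i (c i)) * g (c i₀) =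
      ∏ i, ρ i (c i) * (if h : i = i₀ then g (h ▸ c i) else 1) := by
    intro c
    rw [Finset.prod_mul_distrib]
    congr 1
    rw [Finset.prod_eq_single i₀] <;> simp +contextual
  simp_rw [h]
  rw [sum_pi_prod (fun i x => ρ i x * (if h : i = i₀ then g (h ▸ x) else 1)),
    Finset.prod_eq_single i₀]
  · simp
  · intro i _ hi
    simp [hi, hρ]
  · simp

theorem sum_pi_prod_mul_mul {C : Type*} [Fintype C] (ρ : ι → C → ℝ)
    (hρ : ∀ i, ∑ x, ρ i x = 1) {i₀ j₀ : ι} (hij : i₀ ≠ j₀) (f g : C → ℝ) :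
    ∑ c : ι → C, (∏ i, ρ i (c i)) * (f (c i₀) * g (c j₀)) =
      (∑ x, ρ i₀ x * f x) * ∑ x, ρ j₀ x * g x := by
  have h : ∀ c : ι → C, (∏ i, ρ i (c i)) * (f (c i₀) * g (c j₀)) =
      ∏ i, ρ i (c i) * ((if i = i₀ then f (c i) else 1) * (if i = j₀ then g (c i) else 1)) := by
    intro c
    rw [Finset.prod_mul_distrib, Finset.prod_mul_distrib]
    simp
  simp_rw [h]
  rw [sum_pi_prod (fun i x =>
    ρ i x * ((if i = i₀ then f x else 1) * (if i = j₀ then g x else 1))),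
    ← Finset.mul_prod_erase _ _ (Finset.mem_univ i₀),
    ← Finset.mul_prod_erase _ _ (Finset.mem_erase.2 ⟨hij.symm, Finset.mem_univ j₀⟩),
    Finset.prod_eq_one]
  · simp [hij, hij.symm]
  · intro i hi
    simp only [Finset.mem_erase, Finset.mem_univ, and_true] at hi
    simp [hi.1, hi.2, hρ]

theorem sum_curry_prod_mul_mul {κ C : Type*} [Fintype κ] [DecidableEq κ] [Fintype C]
    (ρ : ι → κ → C → ℝ) (hρ : ∀ a b, ∑ x, ρ a b x = 1) {p p' : ι × κ} (hp : p ≠ p')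
    (f g : C → ℝ) :
    ∑ c : ι → κ → C, (∏ a, ∏ b, ρ a b (c a b)) * (f (c p.1 p.2) * g (c p'.1 p'.2)) =
      (∑ x, ρ p.1 p.2 x * f x) * ∑ x, ρ p'.1 p'.2 x * g x := by
  rw [← sum_pi_prod_mul_mul (fun q : ι × κ => ρ q.1 q.2) (fun q => hρ q.1 q.2) hp f g,
    ← (Equiv.curry ι κ C).sum_comp]
  refine Finset.sum_congr rfl fun c _ => ?_
  rw [Fintype.prod_prod_type]
  rfl

theorem sum_curry_prod_mul_prod {κ C : Type*} [Fintype κ] [DecidableEq κ] [Fintype C]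
    (ρ : ι → κ → C → ℝ) (f : C → ℝ) :
    ∑ c : ι → κ → C, (∏ a, ∏ b, ρ a b (c a b)) * ∏ a, ∏ b, f (c a b) =
      ∏ a, ∏ b, ∑ x, ρ a b x * f x := by
  simp_rw [← Finset.prod_mul_distrib]
  rw [sum_pi_prod (C := fun _ => κ → C) fun a c => ∏ b, ρ a b (c b) * f (c b)]
  exact Finset.prod_congr rfl fun a _ => sum_pi_prod (C := fun _ => C) fun b x => ρ a b x * f x

theorem sum_sum_eq_sum_sumElim {κ C : Type*} [Fintype κ] [DecidableEq κ] [Fintype C]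
    (f : (ι → C) → (κ → C) → ℝ) :
    ∑ A, ∑ B, f A B = ∑ c : ι ⊕ κ → C, f (fun a => c (Sum.inl a)) fun b => c (Sum.inr b) := by
  rw [← (Equiv.sumArrowEquivProdArrow ι κ C).symm.sum_comp, Fintype.sum_prod_type]
  rfl

/-- Jensen's inequality, twice: the complete bipartite graph has at least the density that it has
in a random weighted bipartite graph. This is Sidorenko's inequality for complete bipartite
graphs. -/
theorem pow_le_sum_prod_prod {W : Type*} [Fintype W] (N : ℕ) (ρ : W → ℝ) (hρ0 : ∀ w, 0 ≤ ρ w)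
    (hρ : ∑ w, ρ w = 1) (g : W → W → ℝ) (hg : ∀ v w, 0 ≤ g v w) :
    (∑ v, ∑ w, ρ v * ρ w * g v w) ^ (N * N) ≤
      ∑ A : Fin N → W, ∑ B : Fin N → W,
        (∏ a, ρ (A a)) * (∏ b, ρ (B b)) * ∏ a, ∏ b, g (A a) (B b) := by
  have h1 : ∀ A : Fin N → W, ∑ B : Fin N → W,
      (∏ a, ρ (A a)) * (∏ b, ρ (B b)) * ∏ a, ∏ b, g (A a) (B b) =
      (∏ a, ρ (A a)) * (∑ w, ρ w * ∏ a, g (A a) w) ^ N := by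
    intro A
    have : (∑ w, ρ w * ∏ a, g (A a) w) ^ N =
        ∏ b : Fin N, ∑ w, ρ w * ∏ a, g (A a) w := by simp
    rw [this, ← sum_pi_prod, Finset.mul_sum]
    refine Finset.sum_congr rfl fun B _ => ?_
    rw [Finset.prod_mul_distrib, Finset.prod_comm, mul_assoc]
  simp_rw [h1]
  have h2 := Real.pow_arith_mean_le_arith_mean_pow Finset.univ
    (fun A : Fin N → W => ∏ a, ρ (A a)) (fun A => ∑ w, ρ w * ∏ a, g (A a) w)
    (fun A _ => Finset.prod_nonneg fun a _ => hρ0 _)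
    (sum_pi_prod_eq_one (C := fun _ => W) (fun (_ : Fin N) w => ρ w) fun _ => hρ)
    (fun A _ => Finset.sum_nonneg fun w _ => mul_nonneg (hρ0 w)
      (Finset.prod_nonneg fun a _ => hg _ _)) N
  refine le_trans ?_ h2
  rw [pow_mul]
  have h3 : ∑ A : Fin N → W, (∏ a, ρ (A a)) * ∑ w, ρ w * ∏ a, g (A a) w =
      ∑ w, ρ w * (∑ v, ρ v * g v w) ^ N := by
    simp_rw [Finset.mul_sum]
    rw [Finset.sum_comm]
    refine Finset.sum_congr rfl fun w _ => ?_
    have : (∑ v, ρ v * g v w) ^ N = ∏ _a : Fin N, ∑ v, ρ v * g v w := by simp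
    rw [this, ← sum_pi_prod, Finset.mul_sum]
    refine Finset.sum_congr rfl fun A _ => ?_
    rw [Finset.prod_mul_distrib]
    ring
  rw [h3]
  have h4 := Real.pow_arith_mean_le_arith_mean_pow Finset.univ ρ (fun w => ∑ v, ρ v * g v w)
    (fun w _ => hρ0 w) hρ
    (fun w _ => Finset.sum_nonneg fun v _ => mul_nonneg (hρ0 v) (hg _ _)) N
  have h5 : ∑ v, ∑ w, ρ v * ρ w * g v w = ∑ w, ρ w * ∑ v, ρ v * g v w := by
    rw [Finset.sum_comm]
    refine Finset.sum_congr rfl fun w _ => ?_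
    rw [Finset.mul_sum]
    exact Finset.sum_congr rfl fun v _ => by ring
  rw [h5]
  have h6 : 0 ≤ ∑ w, ρ w * ∑ v, ρ v * g v w :=
    Finset.sum_nonneg fun w _ => mul_nonneg (hρ0 w)
      (Finset.sum_nonneg fun v _ => mul_nonneg (hρ0 v) (hg _ _))
  exact pow_le_pow_left₀ (pow_nonneg h6 N) h4 N

/-! ### Collisions between two independent samples -/

/-- The second moment of occupation numbers of `k` independent samples. -/
theorem sum_prod_mul_count_mul_count {W V : Type*} [Fintype W] [DecidableEq V] (k : ℕ)
    (ρ : W → ℝ) (hρ : ∑ w, ρ w = 1) (hρ0 : ∀ w, 0 ≤ ρ w) (φ : V → W → ℝ)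
    (hφ0 : ∀ u w, 0 ≤ φ u w)
    (hφ : ∀ u v w, φ u w * φ v w = if u = v then φ u w else 0) (u v : V) :
    ∑ c : Fin k → W, (∏ m, ρ (c m)) * ((∑ m, φ u (c m)) * ∑ m, φ v (c m)) ≤
      (k : ℝ) ^ 2 * ((∑ w, ρ w * φ u w) * ∑ w, ρ w * φ v w) +
        if u = v then k * ∑ w, ρ w * φ u w else 0 := by
  have hq : ∀ u, 0 ≤ ∑ w, ρ w * φ u w := fun u =>
    Finset.sum_nonneg fun w _ => mul_nonneg (hρ0 w) (hφ0 u w)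
  have h1 : ∑ c : Fin k → W, (∏ m, ρ (c m)) * ((∑ m, φ u (c m)) * ∑ m, φ v (c m)) =
      ∑ m, ∑ m', ∑ c : Fin k → W, (∏ m, ρ (c m)) * (φ u (c m) * φ v (c m')) := by
    simp_rw [Finset.sum_mul_sum, Finset.mul_sum]
    rw [Finset.sum_comm]
    refine Finset.sum_congr rfl fun m _ => ?_
    rw [Finset.sum_comm]
  rw [h1]
  have h2 : ∀ m m' : Fin k, ∑ c : Fin k → W, (∏ m, ρ (c m)) * (φ u (c m) * φ v (c m')) ≤
      ((∑ w, ρ w * φ u w) * ∑ w, ρ w * φ v w) +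
        if m = m' then (if u = v then ∑ w, ρ w * φ u w else 0) else 0 := by
    intro m m'
    split_ifs with hm huv
    · subst hm
      have := mul_nonneg (hq u) (hq v)
      rw [sum_pi_prod_mul (C := fun _ => W) (fun _ w => ρ w) (fun _ => hρ) m
        (fun w => φ u w * φ v w)]
      simp_rw [hφ]
      simp only [huv, if_true]
      subst huv
      linarith
    · subst hm
      have := mul_nonneg (hq u) (hq v)
      rw [sum_pi_prod_mul (C := fun _ => W) (fun _ w => ρ w) (fun _ => hρ) m
        (fun w => φ u w * φ v w)]
      simp_rw [hφ]
      simp only [huv, if_false, mul_zero, Finset.sum_const_zero]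
      linarith
    · rw [sum_pi_prod_mul_mul (fun _ w => ρ w) (fun _ => hρ) hm (φ u) (φ v)]
      simp
  refine (Finset.sum_le_sum fun m _ => Finset.sum_le_sum fun m' _ => h2 m m').trans ?_
  simp_rw [Finset.sum_add_distrib]
  refine add_le_add ?_ ?_
  · simp [sq, mul_assoc]
  · split_ifs <;> simp

open Classical in
/-- The second moment method. Two families of `k` independent samples, the samples being labelled
(partially) by `V` through the indicators `φ`, with label distributions `p` and `q` bounded by `B`,
share a label with probability at least `1/2` as soon as `k ⟨p, q⟩ ≥ 4 B` and
`k ^ 2 ⟨p, q⟩ ≥ 2`. -/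
theorem half_le_collision {W V : Type*} [Fintype W] [Fintype V] [DecidableEq V] (k : ℕ)
    (ρ σ : W → ℝ) (hρ : ∑ w, ρ w = 1) (hρ0 : ∀ w, 0 ≤ ρ w) (hσ : ∑ w, σ w = 1)
    (hσ0 : ∀ w, 0 ≤ σ w) (φ : V → W → ℝ) (hφ0 : ∀ u w, 0 ≤ φ u w)
    (hφ : ∀ u v w, φ u w * φ v w = if u = v then φ u w else 0)
    (p q : V → ℝ) (hp : ∀ u, ∑ w, ρ w * φ u w = p u) (hq : ∀ u, ∑ w, σ w * φ u w = q u)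
    (B : ℝ) (hpB : ∀ u, p u ≤ B) (hqB : ∀ u, q u ≤ B)
    (h1 : 4 * B ≤ k * ∑ u, p u * q u) (h2 : 2 ≤ (k : ℝ) ^ 2 * ∑ u, p u * q u) :
    1 / 2 ≤ ∑ c : (Fin k → W) × (Fin k → W), (∏ m, ρ (c.1 m)) * (∏ m, σ (c.2 m)) *
      if ∃ m m' u, φ u (c.1 m) ≠ 0 ∧ φ u (c.2 m') ≠ 0 then 1 else 0 := by
  set μ := ∑ u, p u * q u with hμ
  have hp0 : ∀ u, 0 ≤ p u := fun u => hp u ▸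
    Finset.sum_nonneg fun w _ => mul_nonneg (hρ0 w) (hφ0 u w)
  have hq0 : ∀ u, 0 ≤ q u := fun u => hq u ▸
    Finset.sum_nonneg fun w _ => mul_nonneg (hσ0 w) (hφ0 u w)
  have hμ0 : 0 ≤ μ := Finset.sum_nonneg fun u _ => mul_nonneg (hp0 u) (hq0 u)
  -- `M` counts the samples with a given label, `Z` the pairs of samples with a common label, and
  -- the second moment of `Z` factors into second moments of the counts.
  let M : (Fin k → W) → V → ℝ := fun c u => ∑ m, φ u (c m)
  let Z : (Fin k → W) × (Fin k → W) → ℝ := fun c => ∑ u, M c.1 u * M c.2 u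
  let π : (Fin k → W) × (Fin k → W) → ℝ := fun c => (∏ m, ρ (c.1 m)) * (∏ m, σ (c.2 m))
  let I : (Fin k → W) × (Fin k → W) → ℝ :=
    fun c => if ∃ m m' u, φ u (c.1 m) ≠ 0 ∧ φ u (c.2 m') ≠ 0 then 1 else 0
  have hπ0 : ∀ c, 0 ≤ π c := fun c => mul_nonneg (Finset.prod_nonneg fun m _ => hρ0 _)
    (Finset.prod_nonneg fun m _ => hσ0 _)
  have first : ∀ (τ : W → ℝ), ∑ w, τ w = 1 → ∀ u, ∑ c : Fin k → W, (∏ m, τ (c m)) * M c u =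
      k * ∑ w, τ w * φ u w := by
    intro τ hτ u
    simp only [M, Finset.mul_sum]
    rw [Finset.sum_comm]
    rw [Finset.sum_congr rfl fun m _ =>
      sum_pi_prod_mul (C := fun _ => W) (fun _ w => τ w) (fun _ => hτ) m (φ u)]
    simp [Finset.mul_sum]
  have hEZ : ∑ c, π c * Z c = (k : ℝ) ^ 2 * μ := by
    have : ∑ c, π c * Z c = ∑ u, (∑ c : Fin k → W, (∏ m, ρ (c m)) * M c u) *
        ∑ c : Fin k → W, (∏ m, σ (c m)) * M c u := by
      simp_rw [Finset.sum_mul_sum, Z, π, Finset.mul_sum]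
      rw [Fintype.sum_prod_type, Finset.sum_comm' (t' := Finset.univ) (s' := fun _ => Finset.univ)
        (by simp)]
      rw [Finset.sum_comm (s := (Finset.univ : Finset V))]
      rw [Finset.sum_comm]
      refine Finset.sum_congr rfl fun c _ => ?_
      rw [Finset.sum_comm]
      refine Finset.sum_congr rfl fun u _ => Finset.sum_congr rfl fun c' _ => ?_
      ring
    rw [this, hμ, Finset.mul_sum]
    refine Finset.sum_congr rfl fun u _ => ?_
    rw [first ρ hρ, first σ hσ, hp, hq]
    ring
  have hEZ2 : ∑ c, π c * Z c ^ 2 ≤ (k : ℝ) ^ 4 * μ ^ 2 + 2 * k ^ 3 * B * μ + k ^ 2 * μ := by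
    have e : ∑ c, π c * Z c ^ 2 =
        ∑ u, ∑ v, (∑ c : Fin k → W, (∏ m, ρ (c m)) * (M c u * M c v)) *
        ∑ c : Fin k → W, (∏ m, σ (c m)) * (M c u * M c v) := by
      simp_rw [Finset.sum_mul_sum, Z, π, sq, Finset.sum_mul_sum, Finset.mul_sum]
      rw [Fintype.sum_prod_type]
      have l : ∀ f : (Fin k → W) → (Fin k → W) → V → V → ℝ,
          ∑ c, ∑ c', ∑ u, ∑ v, f c c' u v = ∑ u, ∑ v, ∑ c, ∑ c', f c c' u v := by
        intro f
        calc _ = ∑ c, ∑ u, ∑ c', ∑ v, f c c' u v :=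
              Finset.sum_congr rfl fun c _ => Finset.sum_comm
          _ = ∑ u, ∑ c, ∑ v, ∑ c', f c c' u v := by
              rw [Finset.sum_comm]
              exact Finset.sum_congr rfl fun u _ => Finset.sum_congr rfl fun c _ =>
                Finset.sum_comm
          _ = _ := Finset.sum_congr rfl fun u _ => Finset.sum_comm
      rw [l]
      refine Finset.sum_congr rfl fun u _ => Finset.sum_congr rfl fun v _ =>
        Finset.sum_congr rfl fun c _ => Finset.sum_congr rfl fun c' _ => ?_
      ring
    have b : ∀ u v, (∑ c : Fin k → W, (∏ m, ρ (c m)) * (M c u * M c v)) *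
        (∑ c : Fin k → W, (∏ m, σ (c m)) * (M c u * M c v)) ≤
        (k ^ 2 * (p u * p v) + if u = v then k * p u else 0) *
        (k ^ 2 * (q u * q v) + if u = v then k * q u else 0) := by
      intro u v
      have hM : ∀ c u, 0 ≤ M c u := fun c u => Finset.sum_nonneg fun m _ => hφ0 _ _
      have b1 := sum_prod_mul_count_mul_count k ρ hρ hρ0 φ hφ0 hφ u v
      have b2 := sum_prod_mul_count_mul_count k σ hσ hσ0 φ hφ0 hφ u v
      rw [hp, hp] at b1
      rw [hq, hq] at b2
      refine mul_le_mul b1 b2 ?_ ?_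
      · exact Finset.sum_nonneg fun c _ => mul_nonneg (Finset.prod_nonneg fun m _ => hσ0 _)
          (mul_nonneg (hM _ _) (hM _ _))
      · have := mul_nonneg (hp0 u) (hp0 v)
        have := hp0 u
        split_ifs <;> positivity
    rw [e]
    refine (Finset.sum_le_sum fun u _ => Finset.sum_le_sum fun v _ => b u v).trans ?_
    have e2 : ∀ u v, (k ^ 2 * (p u * p v) + if u = v then k * p u else 0) *
        (k ^ 2 * (q u * q v) + if u = v then k * q u else 0) =
        k ^ 4 * ((p u * q u) * (p v * q v)) + if u = v then
          k ^ 3 * (p u * q u) * (p u + q u) + k ^ 2 * (p u * q u) else 0 := by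
      intro u v
      split_ifs with h
      · subst h; ring
      · ring
    simp_rw [e2, Finset.sum_add_distrib]
    have e3 : ∑ u, ∑ v, (k : ℝ) ^ 4 * ((p u * q u) * (p v * q v)) = k ^ 4 * μ ^ 2 := by
      rw [hμ, sq, Finset.sum_mul_sum, Finset.mul_sum]
      simp_rw [Finset.mul_sum]
    rw [e3]
    simp only [Finset.sum_ite_eq, Finset.mem_univ, if_true, Finset.sum_add_distrib]
    rw [← Finset.mul_sum, add_assoc]
    gcongr
    rw [hμ, Finset.mul_sum]
    refine Finset.sum_le_sum fun u _ => ?_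
    have hk : (0:ℝ) ≤ k ^ 3 := by positivity
    nlinarith [mul_le_mul_of_nonneg_left (add_le_add (hpB u) (hqB u))
      (mul_nonneg hk (mul_nonneg (hp0 u) (hq0 u)))]
  have hZI : ∀ c, Z c = Z c * I c := by
    intro c
    simp only [I]
    split_ifs with h
    · simp
    · have : Z c = 0 := by
        refine Finset.sum_eq_zero fun u _ => ?_
        simp only [M]
        rw [Finset.sum_mul_sum]
        refine Finset.sum_eq_zero fun m _ => Finset.sum_eq_zero fun m' _ => ?_
        by_contra hne
        exact h ⟨m, m', u, left_ne_zero_of_mul hne, right_ne_zero_of_mul hne⟩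
      simp [this]
  have hI0 : ∀ c, 0 ≤ I c := fun c => by simp only [I]; split_ifs <;> norm_num
  have hII : ∀ c, I c ^ 2 = I c := fun c => by simp only [I]; split_ifs <;> norm_num
  have cs : (∑ c, π c * Z c) ^ 2 ≤ (∑ c, π c * I c) * ∑ c, π c * Z c ^ 2 := by
    refine Finset.sum_sq_le_sum_mul_sum_of_sq_le_mul _ (fun c _ => mul_nonneg (hπ0 c) (hI0 c))
      (fun c _ => mul_nonneg (hπ0 c) (sq_nonneg _)) fun c _ => le_of_eq ?_
    have hz : Z c ^ 2 = Z c ^ 2 * I c := by rw [← hII c, ← mul_pow, ← hZI]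
    calc (π c * Z c) ^ 2 = π c ^ 2 * Z c ^ 2 := by ring
      _ = π c ^ 2 * (Z c ^ 2 * I c) := by rw [← hz]
      _ = π c * I c * (π c * Z c ^ 2) := by ring
  have hP0 : 0 ≤ ∑ c, π c * I c := Finset.sum_nonneg fun c _ => mul_nonneg (hπ0 c) (hI0 c)
  change 1 / 2 ≤ ∑ c, π c * I c
  rw [hEZ] at cs
  set E := (k : ℝ) ^ 2 * μ with hE
  have hb : ∑ c, π c * Z c ^ 2 ≤ 2 * E ^ 2 := by
    refine hEZ2.trans ?_
    have s1 : 2 * (k : ℝ) ^ 3 * B * μ ≤ E ^ 2 / 2 := by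
      have : 0 ≤ (k : ℝ) ^ 3 * μ := by positivity
      nlinarith [mul_le_mul_of_nonneg_left h1 this]
    have s2 : (k : ℝ) ^ 2 * μ ≤ E ^ 2 / 2 := by
      nlinarith
    have s3 : (k : ℝ) ^ 4 * μ ^ 2 = E ^ 2 := by rw [hE]; ring
    linarith
  have hE2 : 0 < E ^ 2 := by positivity
  have := cs.trans (mul_le_mul_of_nonneg_left hb hP0)
  by_contra hlt
  push Not at hlt
  nlinarith

end ProductWeights

/-! ### Walks and powers of the transition matrix -/

section Walks

variable {n : ℕ} (G : SimpleGraph (Fin n)) [DecidableRel G.Adj] (d : ℕ)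

theorem lazyStep_comm (u v : Fin n) : lazyStep G d u v = lazyStep G d v u := by
  unfold lazyStep
  by_cases h : u = v
  · subst h; rfl
  · simp [h, Ne.symm h, G.adj_comm]

theorem lazyStep_nonneg (hd : 0 < d) (hG : ∀ v, G.degree v ≤ d) (u v : Fin n) :
    0 ≤ lazyStep G d u v := by
  unfold lazyStep
  split_ifs
  · have h1 : (G.degree u : ℝ) ≤ d := by exact_mod_cast hG u
    have h2 : (0 : ℝ) < d := by exact_mod_cast hd
    rw [sub_nonneg, div_le_one (by positivity)]
    linarith
  · positivity
  · exact le_rfl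

theorem sum_lazyStep (u : Fin n) : ∑ v, lazyStep G d u v = 1 := by
  have h : ∀ v, lazyStep G d u v = (if u = v then 1 - (G.degree u : ℝ) / (2 * d) else 0) +
      if G.Adj u v then 1 / (2 * d : ℝ) else 0 := by
    intro v
    unfold lazyStep
    by_cases h : u = v
    · subst h; simp
    · simp [h]
  simp_rw [h, Finset.sum_add_distrib]
  rw [← Finset.sum_filter (fun v => G.Adj u v), ← SimpleGraph.neighborFinset_eq_filter]
  simp
  ring

/-- The transition matrix of the lazy random walk. -/
noncomputable def stepMatrix : Matrix (Fin n) (Fin n) ℝ := Matrix.of (lazyStep G d)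

theorem isSymm_stepMatrix : (stepMatrix G d).IsSymm :=
  Matrix.ext fun u v => lazyStep_comm G d v u

theorem stepMatrix_pow_nonneg (hd : 0 < d) (hG : ∀ v, G.degree v ≤ d) (t : ℕ) (u v : Fin n) :
    0 ≤ (stepMatrix G d ^ t) u v := by
  induction t generalizing v with
  | zero => simp only [pow_zero, Matrix.one_apply]; split_ifs <;> norm_num
  | succ t ih =>
    rw [pow_succ, Matrix.mul_apply]
    exact Finset.sum_nonneg fun x _ => mul_nonneg (ih x) (lazyStep_nonneg G d hd hG x v)

theorem sum_stepMatrix_pow (t : ℕ) (u : Fin n) : ∑ v, (stepMatrix G d ^ t) u v = 1 := by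
  induction t with
  | zero => simp [Matrix.one_apply]
  | succ t ih =>
    simp_rw [pow_succ, Matrix.mul_apply]
    rw [Finset.sum_comm]
    simp_rw [← Finset.mul_sum]
    simp only [stepMatrix, Matrix.of_apply, sum_lazyStep, mul_one]
    exact ih

theorem sum_stepMatrix_pow' (t : ℕ) (v : Fin n) : ∑ u, (stepMatrix G d ^ t) u v = 1 := by
  rw [← sum_stepMatrix_pow G d t v]
  exact Finset.sum_congr rfl fun u _ => ((isSymm_stepMatrix G d).pow t).apply v u

theorem walkProb_nonneg (hd : 0 < d) (hG : ∀ v, G.degree v ≤ d) {L : ℕ} (u : Fin n)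
    (w : Walk n L) : 0 ≤ walkProb G d u w := by
  unfold walkProb
  split_ifs
  · exact Finset.prod_nonneg fun t _ => lazyStep_nonneg G d hd hG _ _
  · exact le_rfl

theorem sum_walk_snoc {L : ℕ} (f : Walk n (L + 1) → ℝ) :
    ∑ w, f w = ∑ w : Walk n L, ∑ x, f (Fin.snoc (α := fun _ => Fin n) w x) := by
  rw [← (Fin.snocEquiv fun _ : Fin (L + 2) => Fin n).sum_comp, Fintype.sum_prod_type,
    Finset.sum_comm]
  rfl

theorem walkProb_snoc {L : ℕ} (u : Fin n) (w : Walk n L) (x : Fin n) :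
    walkProb G d u (Fin.snoc (α := fun _ => Fin n) w x : Walk n (L + 1)) =
      walkProb G d u w * lazyStep G d (w (Fin.last L)) x := by
  unfold walkProb
  have h0 : (Fin.snoc (α := fun _ => Fin n) w x : Walk n (L + 1)) 0 = w 0 :=
    Fin.snoc_castSucc (α := fun _ => Fin n) x w 0
  rw [h0, ite_mul, zero_mul]
  congr 1
  rw [Fin.prod_univ_castSucc]
  simp only [Fin.succ_castSucc, Fin.snoc_castSucc, Fin.succ_last, Fin.snoc_last]

theorem sum_walkProb_mul_last {L : ℕ} (u : Fin n) (f : Fin n → ℝ) :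
    ∑ w : Walk n L, walkProb G d u w * f (w (Fin.last L)) =
      ∑ x, (stepMatrix G d ^ L) u x * f x := by
  induction L generalizing f with
  | zero =>
    rw [← (Equiv.funUnique (Fin 1) (Fin n)).symm.sum_comp]
    refine Finset.sum_congr rfl fun x _ => ?_
    simp [walkProb, Matrix.one_apply, eq_comm]
  | succ L ih =>
    rw [sum_walk_snoc]
    simp only [walkProb_snoc, Fin.snoc_last, mul_assoc]
    simp_rw [← Finset.mul_sum]
    rw [ih (fun y => ∑ x, lazyStep G d y x * f x)]
    simp_rw [pow_succ, Matrix.mul_apply, Finset.sum_mul, Finset.mul_sum]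
    rw [Finset.sum_comm]
    refine Finset.sum_congr rfl fun x _ => Finset.sum_congr rfl fun y _ => ?_
    simp [stepMatrix, mul_assoc]

theorem sum_walkProb_mul {L : ℕ} (u : Fin n) (t : Fin (L + 1)) (f : Fin n → ℝ) :
    ∑ w : Walk n L, walkProb G d u w * f (w t) = ∑ x, (stepMatrix G d ^ (t : ℕ)) u x * f x := by
  induction L with
  | zero =>
    obtain rfl : t = Fin.last 0 := Subsingleton.elim (α := Fin 1) _ _
    exact sum_walkProb_mul_last G d u f
  | succ L ih =>
    cases t using Fin.lastCases with
    | last => exact sum_walkProb_mul_last G d u f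
    | cast t =>
      rw [sum_walk_snoc]
      simp only [walkProb_snoc, Fin.snoc_castSucc, Fin.val_castSucc]
      rw [← ih t]
      refine Finset.sum_congr rfl fun w _ => ?_
      rw [← Finset.sum_mul, ← Finset.mul_sum, sum_lazyStep, mul_one]

theorem sum_walkProb {L : ℕ} (u : Fin n) : ∑ w : Walk n L, walkProb G d u w = 1 := by
  have := sum_walkProb_mul_last G d (L := L) u fun _ => 1
  simpa [sum_stepMatrix_pow] using this

/-! ### Returning probabilities -/

/-- The walk is in `R` at every positive time divisible by `l`. -/
def Returning {L : ℕ} (l : ℕ) (R : Set (Fin n)) (w : Walk n L) : Prop :=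
  ∀ t : Fin (L + 1), 0 < (t : ℕ) → l ∣ (t : ℕ) → w t ∈ R

open Classical in
/-- The diagonal matrix that restricts to the vertices in `R`. -/
noncomputable def restrictMatrix (R : Set (Fin n)) : Matrix (Fin n) (Fin n) ℝ :=
  Matrix.diagonal fun v => if v ∈ R then 1 else 0

theorem restrictMatrix_mul_self (R : Set (Fin n)) :
    restrictMatrix R * restrictMatrix R = restrictMatrix R := by
  simp [restrictMatrix, Matrix.diagonal_mul_diagonal]

theorem restrictMatrix_mul_apply {R : Set (Fin n)} {s : Fin n} (hs : s ∈ R)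
    (A : Matrix (Fin n) (Fin n) ℝ) (u : Fin n) : (restrictMatrix R * A) s u = A s u := by
  simp [restrictMatrix, hs]

theorem mul_restrictMatrix_apply {R : Set (Fin n)} {u : Fin n} (hu : u ∈ R)
    (A : Matrix (Fin n) (Fin n) ℝ) (s : Fin n) : (A * restrictMatrix R) s u = A s u := by
  simp [restrictMatrix, hu]

theorem returning_snoc {L : ℕ} (l : ℕ) (R : Set (Fin n)) (w : Walk n L) (x : Fin n) :
    Returning l R (Fin.snoc (α := fun _ => Fin n) w x : Walk n (L + 1)) ↔
      Returning l R w ∧ (l ∣ L + 1 → x ∈ R) := by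
  constructor
  · intro h
    refine ⟨fun t h0 ht => ?_, fun hl => ?_⟩
    · simpa using h t.castSucc (by simpa using h0) (by simpa using ht)
    · simpa using h (Fin.last _) (by simp) (by simpa using hl)
  · rintro ⟨h1, h2⟩ t h0 ht
    cases t using Fin.lastCases with
    | last => simpa using h2 (by simpa using ht)
    | cast t => simpa using h1 t (by simpa using h0) (by simpa using ht)

open Classical in
/-- The probability that a walk of length `L` from `s` is returning and ends at `u`. -/
noncomputable def returnWeight (l : ℕ) (R : Set (Fin n)) (L : ℕ) : Matrix (Fin n) (Fin n) ℝ :=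
  Matrix.of fun s u =>
    ∑ w : Walk n L, if w (Fin.last L) = u ∧ Returning l R w then walkProb G d s w else 0

theorem returnWeight_zero (l : ℕ) (R : Set (Fin n)) : returnWeight G d l R 0 = 1 := by
  classical
  ext s u
  simp only [returnWeight, Matrix.of_apply]
  rw [← (Equiv.funUnique (Fin 1) (Fin n)).symm.sum_comp]
  have h : ∀ w : Walk n 0, Returning l R w := fun w t h0 => by simp at h0
  simp [walkProb, Matrix.one_apply, h, eq_comm]

theorem returnWeight_succ (l : ℕ) (R : Set (Fin n)) (L : ℕ) :
    returnWeight G d l R (L + 1) = returnWeight G d l R L *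
      (stepMatrix G d * if l ∣ L + 1 then restrictMatrix R else 1) := by
  classical
  ext s u
  rw [Matrix.mul_apply]
  have h : ∀ x, (stepMatrix G d * if l ∣ L + 1 then restrictMatrix R else 1) x u =
      if (l ∣ L + 1 → u ∈ R) then lazyStep G d x u else 0 := by
    intro x
    by_cases h : l ∣ L + 1
    · simp [h, restrictMatrix, stepMatrix]
    · simp [h, stepMatrix]
  simp only [h, returnWeight, Matrix.of_apply]
  rw [sum_walk_snoc]
  simp_rw [Finset.sum_mul]
  rw [Finset.sum_comm (γ := Fin n) (α := Walk n L)]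
  refine Finset.sum_congr rfl fun w _ => ?_
  simp only [Fin.snoc_last, returning_snoc, walkProb_snoc]
  rw [Finset.sum_eq_single u, Finset.sum_eq_single (w (Fin.last L))]
  · by_cases h1 : Returning l R w <;> by_cases h2 : (l ∣ L + 1 → u ∈ R) <;> simp [h1, h2]
  · intro x _ hx
    simp [Ne.symm hx]
  · simp
  · intro x _ hx
    simp [hx]
  · simp

theorem returnWeight_mul_add {l : ℕ} (R : Set (Fin n)) (m j : ℕ) (hj : j < l) :
    returnWeight G d l R (m * l + j) =
      (stepMatrix G d ^ l * restrictMatrix R) ^ m * stepMatrix G d ^ j := by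
  induction m generalizing j with
  | zero =>
    induction j with
    | zero => simp [returnWeight_zero]
    | succ j ih =>
      have : ¬ l ∣ 0 * l + j + 1 := by
        rw [zero_mul, zero_add]
        exact Nat.not_dvd_of_pos_of_lt (Nat.succ_pos j) hj
      rw [← add_assoc, returnWeight_succ, if_neg this, ih (by omega), mul_one, pow_succ,
        mul_assoc]
  | succ m ihm =>
    induction j with
    | zero =>
      obtain ⟨l, rfl⟩ : ∃ l', l = l' + 1 := ⟨l - 1, by omega⟩
      have e : (m + 1) * (l + 1) + 0 = (m * (l + 1) + l) + 1 := by ring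
      have hd : l + 1 ∣ m * (l + 1) + l + 1 := ⟨m + 1, by ring⟩
      rw [e, returnWeight_succ, ihm l (by omega), if_pos hd, pow_zero, mul_one, pow_succ _ m,
        pow_succ _ l]
      simp only [mul_assoc]
    | succ j ih =>
      have : ¬ l ∣ (m + 1) * l + j + 1 := by
        rw [add_assoc, Nat.dvd_add_right (Dvd.intro_left _ rfl)]
        exact Nat.not_dvd_of_pos_of_lt (Nat.succ_pos j) hj
      rw [← add_assoc, returnWeight_succ, if_neg this, ih (by omega), mul_one, pow_succ _ j,
        mul_assoc]

/-- Returning probabilities are the entries of a power of `P ^ l * D`. -/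
theorem returnProb_eq_pow {l : ℕ} (hl : 0 < l) (R : Set (Fin n)) (i : ℕ) (s u : Fin n) :
    returnProb G d l R i s u = ((stepMatrix G d ^ l * restrictMatrix R) ^ 2 ^ i) s u := by
  have := returnWeight_mul_add G d R (2 ^ i) 0 hl
  rw [add_zero, pow_zero, mul_one] at this
  rw [← this]
  simp only [returnProb, returnWeight, Matrix.of_apply]
  refine Finset.sum_congr rfl fun w _ => ?_
  congr

open Classical in
/-- The indicator of the returning walks. -/
noncomputable def returnIndicator {L : ℕ} (l : ℕ) (R : Set (Fin n)) (w : Walk n L) : ℝ :=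
  if Returning l R w then 1 else 0

theorem returnIndicator_nonneg {L : ℕ} (l : ℕ) (R : Set (Fin n)) (w : Walk n L) :
    0 ≤ returnIndicator l R w := by
  unfold returnIndicator; split_ifs <;> norm_num

theorem returnIndicator_le_one {L : ℕ} (l : ℕ) (R : Set (Fin n)) (w : Walk n L) :
    returnIndicator l R w ≤ 1 := by
  unfold returnIndicator; split_ifs <;> norm_num

theorem returnIndicator_eq_one {L : ℕ} {l : ℕ} {R : Set (Fin n)} {w : Walk n L}
    (h : Returning l R w) : returnIndicator l R w = 1 := if_pos h

theorem returning_of_returnIndicator_ne_zero {L : ℕ} {l : ℕ} {R : Set (Fin n)} {w : Walk n L}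
    (h : returnIndicator l R w ≠ 0) : Returning l R w := by
  by_contra h'
  exact h (if_neg h')

theorem Returning.last_mem {l : ℕ} (hl : 0 < l) {R : Set (Fin n)} {i : ℕ}
    {w : Walk n (2 ^ i * l)} (h : Returning l R w) : w (Fin.last _) ∈ R :=
  h _ (by simp [hl]) (by simp)

theorem sum_walkProb_mul_returnIndicator (l : ℕ) (R : Set (Fin n)) (i : ℕ) (s : Fin n)
    (f : Fin n → ℝ) :
    ∑ w : Walk n (2 ^ i * l), walkProb G d s w * (returnIndicator l R w * f (w (Fin.last _))) =
      ∑ u, returnProb G d l R i s u * f u := by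
  classical
  unfold returnProb
  simp_rw [Finset.sum_mul]
  rw [Finset.sum_comm]
  refine Finset.sum_congr rfl fun w _ => ?_
  rw [Finset.sum_eq_single (w (Fin.last _))]
  · by_cases h : Returning l R w
    · rw [returnIndicator_eq_one h, if_pos ⟨rfl, h⟩, one_mul]
    · rw [if_neg fun h' => h h'.2, returnIndicator, if_neg h, zero_mul, mul_zero]
  · intro u _ hu
    rw [if_neg fun h => hu h.1.symm, zero_mul]
  · simp

theorem returnProb_nonneg (hd : 0 < d) (hG : ∀ v, G.degree v ≤ d) (l : ℕ) (R : Set (Fin n))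
    (i : ℕ) (s u : Fin n) : 0 ≤ returnProb G d l R i s u := by
  unfold returnProb
  refine Finset.sum_nonneg fun w _ => ?_
  split_ifs
  · exact walkProb_nonneg G d hd hG s w
  · exact le_rfl

theorem returnProb_mono (hd : 0 < d) (hG : ∀ v, G.degree v ≤ d) (l : ℕ) {R R' : Set (Fin n)}
    (h : R ⊆ R') (i : ℕ) (s u : Fin n) : returnProb G d l R i s u ≤ returnProb G d l R' i s u := by
  unfold returnProb
  refine Finset.sum_le_sum fun w _ => ?_
  have h0 := walkProb_nonneg G d hd hG s w
  by_cases h1 : w (Fin.last _) = u ∧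
      ∀ t : Fin (2 ^ i * l + 1), 0 < (t : ℕ) → l ∣ (t : ℕ) → w t ∈ R
  · rw [if_pos h1, if_pos ⟨h1.1, fun t a b => h (h1.2 t a b)⟩]
  · rw [if_neg h1]
    split_ifs
    · exact h0
    · exact le_rfl

theorem sum_returnProb_le_one (hd : 0 < d) (hG : ∀ v, G.degree v ≤ d) (l : ℕ) (R : Set (Fin n))
    (i : ℕ) (s : Fin n) : ∑ u, returnProb G d l R i s u ≤ 1 := by
  classical
  rw [← sum_walkProb G d (L := 2 ^ i * l) s]
  unfold returnProb
  rw [Finset.sum_comm]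
  refine Finset.sum_le_sum fun w _ => ?_
  rw [Finset.sum_eq_single (w (Fin.last _))]
  · split_ifs
    · exact le_rfl
    · exact walkProb_nonneg G d hd hG s w
  · intro u _ hu
    rw [if_neg fun h => hu h.1.symm]
  · simp

theorem returnProb_of_notMem {l : ℕ} (hl : 0 < l) {R : Set (Fin n)} (i : ℕ) (s : Fin n)
    {u : Fin n} (hu : u ∉ R) : returnProb G d l R i s u = 0 := by
  unfold returnProb
  refine Finset.sum_eq_zero fun w _ => if_neg ?_
  rintro ⟨rfl, h⟩
  exact hu (h _ (by simp [hl]) (by simp))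

theorem restrictMatrix_mul_pow (R : Set (Fin n)) (l m : ℕ) :
    restrictMatrix R * (stepMatrix G d ^ l * restrictMatrix R) ^ m =
      (restrictMatrix R * stepMatrix G d ^ l * restrictMatrix R) ^ m * restrictMatrix R := by
  induction m with
  | zero => simp
  | succ m ih =>
    rw [pow_succ, ← mul_assoc, ih, pow_succ]
    simp only [mul_assoc, restrictMatrix_mul_self]

/-- Returning probabilities between vertices of `R` are symmetric. -/
theorem returnProb_comm {l : ℕ} (hl : 0 < l) {R : Set (Fin n)} (i : ℕ) {s u : Fin n}
    (hs : s ∈ R) (hu : u ∈ R) : returnProb G d l R i s u = returnProb G d l R i u s := by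
  set S := restrictMatrix R * stepMatrix G d ^ l * restrictMatrix R with hS
  have hD : (restrictMatrix R).IsSymm := Matrix.isSymm_diagonal _
  have hP := (isSymm_stepMatrix G d).pow l
  have hsymm : S.IsSymm := by
    unfold Matrix.IsSymm
    rw [hS, Matrix.transpose_mul, Matrix.transpose_mul, hD.eq, hP.eq, mul_assoc]
  have key : ∀ s ∈ R, ∀ u ∈ R, returnProb G d l R i s u = (S ^ 2 ^ i) s u := by
    intro s hs u hu
    rw [returnProb_eq_pow G d hl]
    have h := congrFun (congrFun (restrictMatrix_mul_pow G d R l (2 ^ i)) s) u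
    rw [restrictMatrix_mul_apply hs, mul_restrictMatrix_apply hu] at h
    exact h
  rw [key s hs u hu, key u hu s hs]
  exact (hsymm.pow _).apply u s

theorem returnProb_succ {l : ℕ} (hl : 0 < l) (R : Set (Fin n)) (i : ℕ) (s u : Fin n) :
    returnProb G d l R (i + 1) s u =
      ∑ v, returnProb G d l R i s v * returnProb G d l R i v u := by
  simp_rw [returnProb_eq_pow G d hl]
  rw [← Matrix.mul_apply, ← pow_add, pow_succ, mul_two]

theorem returnProb_succ_eq_dot {l : ℕ} (hl : 0 < l) {R : Set (Fin n)} (i : ℕ) (s : Fin n)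
    {u : Fin n} (hu : u ∈ R) : returnProb G d l R (i + 1) s u =
      ∑ v, returnProb G d l R i s v * returnProb G d l R i u v := by
  rw [returnProb_succ G d hl]
  refine Finset.sum_congr rfl fun v _ => ?_
  by_cases hv : v ∈ R
  · rw [returnProb_comm G d hl i hv hu]
  · rw [returnProb_of_notMem G d hl i s hv, zero_mul, zero_mul]

theorem returnNormSq_eq {l : ℕ} (hl : 0 < l) (R : Set (Fin n)) (i : ℕ) (s : Fin n) :
    returnNormSq G d l R i s = ∑ u, returnProb G d l R i s u ^ 2 := by
  unfold returnNormSq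
  refine Finset.sum_congr rfl fun u _ => ?_
  split_ifs with h
  · rfl
  · rw [returnProb_of_notMem G d hl i s h]; norm_num

end Walks

/-! ### A biclique minor from crossing paths -/

section Minor

variable {V : Type*} {L : ℕ} (F : SimpleGraph V)

theorem reachable_induce_of_prefix (w : Fin (L + 1) → V)
    (hw : ∀ t : Fin L, w t.castSucc = w t.succ ∨ F.Adj (w t.castSucc) (w t.succ)) (S : Set V)
    (h0 : w 0 ∈ S) (T : Fin (L + 1)) (hT : ∀ t ≤ T, w t ∈ S) :
    (F.induce S).Reachable ⟨w 0, h0⟩ ⟨w T, hT T le_rfl⟩ := by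
  induction T using Fin.induction with
  | zero => exact SimpleGraph.Reachable.refl _
  | succ t ih =>
    have hle : t.castSucc ≤ t.succ := Fin.castSucc_le_succ t
    have h1 := ih fun t' ht' => hT t' (ht'.trans hle)
    rcases hw t with h | h
    · have e : (⟨w t.succ, hT _ le_rfl⟩ : S) = ⟨w t.castSucc, hT _ hle⟩ := Subtype.ext h.symm
      rw [e]
      exact h1
    · refine h1.trans (SimpleGraph.Adj.reachable ?_)
      exact h

/-- Paths `X a b`, `Y a b` from the vertices of `A` and `B` that meet at their ends, and that are
otherwise disjoint unless they come from the same pair or have the same origin, form a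
`K_{N,N}` minor. The branch set of `a` is the union of the `X a b`, and the branch set of `b` is
the union over `a` of the part of `Y a b` before it first meets the branch set of `a`. -/
theorem hasMinor_completeBipartiteGraph {N : ℕ} (hN : 2 ≤ N) (α β : Fin N → V)
    (X Y : Fin N → Fin N → Fin (L + 1) → V)
    (hX0 : ∀ a b, X a b 0 = α a) (hY0 : ∀ a b, Y a b 0 = β b)
    (hend : ∀ a b, X a b (Fin.last L) = Y a b (Fin.last L))
    (hXF : ∀ a b (t : Fin L),
      X a b t.castSucc = X a b t.succ ∨ F.Adj (X a b t.castSucc) (X a b t.succ))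
    (hYF : ∀ a b (t : Fin L),
      Y a b t.castSucc = Y a b t.succ ∨ F.Adj (Y a b t.castSucc) (Y a b t.succ))
    (hXX : ∀ a b a' b' t t', a ≠ a' → X a b t ≠ X a' b' t')
    (hYY : ∀ a b a' b' t t', b ≠ b' → Y a b t ≠ Y a' b' t')
    (hXY : ∀ a b a' b' t t', (a, b) ≠ (a', b') → X a b t ≠ Y a' b' t') :
    HasMinor F (completeBipartiteGraph (Fin N) (Fin N)) := by
  let U : Fin N → Set V := fun a => {v | ∃ b t, X a b t = v}
  let W : Fin N → Set V := fun b => {v | ∃ a t, Y a b t = v ∧ ∀ t' ≤ t, Y a b t' ∉ U a}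
  have : Nontrivial (Fin N) := Fin.nontrivial_iff_two_le.2 hN
  have hβ : ∀ a b, β b ∉ U a := by
    rintro a b ⟨b', t, h⟩
    obtain ⟨a', ha'⟩ := exists_ne a
    refine hXY a b' a' b t 0 (fun e => ha' (congrArg Prod.fst e).symm) ?_
    rw [h, hY0]
  have hpre0 : ∀ a b, ∀ t' ≤ (0 : Fin (L + 1)), Y a b t' ∉ U a := by
    intro a b t' ht'
    rw [Fin.le_zero_iff.1 ht', hY0]
    exact hβ a b
  have hUW : ∀ a b, Disjoint (U a) (W b) := by
    intro a b
    rw [Set.disjoint_left]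
    rintro v ⟨b', t, hv⟩ ⟨a', t', hv', hpre⟩
    by_cases ha : a = a'
    · subst ha
      exact hpre t' le_rfl ⟨b', t, hv.trans hv'.symm⟩
    · exact hXY a b' a' b t t' (fun e => ha (congrArg Prod.fst e)) (hv.trans hv'.symm)
  -- Without such an edge, `Y a b` could never enter `U a`, where it ends.
  have hedge : ∀ a b, ∃ x ∈ U a, ∃ y ∈ W b, F.Adj x y := by
    intro a b
    by_contra hno
    have key : ∀ t : Fin (L + 1), ∀ t' ≤ t, Y a b t' ∉ U a := by
      intro t
      induction t using Fin.induction with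
      | zero => exact hpre0 a b
      | succ t ih =>
        intro t' ht'
        rcases ht'.eq_or_lt with rfl | hlt
        · intro hU
          rcases hYF a b t with h | h
          · exact ih _ le_rfl (h ▸ hU)
          · exact hno ⟨_, hU, _, ⟨a, t.castSucc, rfl, ih⟩, h.symm⟩
        · exact ih t' (Fin.le_castSucc_iff.2 hlt)
    exact key (Fin.last L) (Fin.last L) le_rfl ⟨b, Fin.last L, hend a b⟩
  refine ⟨Sum.elim U W, ?_, ?_, ?_⟩
  · rintro (a | b)
    · have h0 : ∀ b, X a b 0 ∈ U a := fun b => ⟨b, 0, rfl⟩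
      have hα : α a ∈ U a := ⟨a, 0, hX0 a a⟩
      rw [SimpleGraph.connected_iff_exists_forall_reachable]
      refine ⟨⟨α a, hα⟩, ?_⟩
      rintro ⟨v, b, t, rfl⟩
      have h := reachable_induce_of_prefix F (X a b) (hXF a b) (U a) (h0 b) t
        fun t' _ => ⟨b, t', rfl⟩
      have e : (⟨X a b 0, h0 b⟩ : U a) = ⟨α a, hα⟩ := Subtype.ext (hX0 a b)
      rw [e] at h
      exact h
    · have h0 : ∀ a, Y a b 0 ∈ W b := fun a => ⟨a, 0, rfl, hpre0 a b⟩
      have hb : β b ∈ W b := hY0 b b ▸ h0 b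
      rw [SimpleGraph.connected_iff_exists_forall_reachable]
      refine ⟨⟨β b, hb⟩, ?_⟩
      rintro ⟨v, a, t, rfl, hpre⟩
      have h := reachable_induce_of_prefix F (Y a b) (hYF a b) (W b) (h0 a) t
        fun t' ht' => ⟨a, t', rfl, fun t'' ht'' => hpre t'' (ht''.trans ht')⟩
      have e : (⟨Y a b 0, h0 a⟩ : W b) = ⟨β b, hb⟩ := Subtype.ext (hY0 a b)
      rw [e] at h
      exact h
  · rintro (a | b) (a' | b') hne
    · rw [Sum.elim_inl, Sum.elim_inl, Set.disjoint_left]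
      rintro v ⟨b, t, hv⟩ ⟨b', t', hv'⟩
      exact hXX a b a' b' t t' (fun e => hne (e ▸ rfl)) (hv.trans hv'.symm)
    · exact hUW a b'
    · exact (hUW a' b).symm
    · rw [Sum.elim_inr, Sum.elim_inr, Set.disjoint_left]
      rintro v ⟨a, t, hv, _⟩ ⟨a', t', hv', _⟩
      exact hYY a b a' b' t t' (fun e => hne (e ▸ rfl)) (hv.trans hv'.symm)
  · rintro (a | b) (a' | b') hadj
    · simp at hadj
    · exact hedge a b'
    · obtain ⟨x, hx, y, hy, h⟩ := hedge a' b
      exact ⟨y, hy, x, hx, h.symm⟩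
    · simp at hadj

end Minor

/-! ### Norm bounds and correlation -/

section Norms

variable {n : ℕ} (G : SimpleGraph (Fin n)) [DecidableRel G.Adj] (d : ℕ)

theorem dot_le_of_returnNormSq_le {l : ℕ} (hl : 0 < l) {R : Set (Fin n)} {i : ℕ} {β : ℝ}
    (h : ∀ v ∈ R, returnNormSq G d l R i v ≤ β) {s u : Fin n} (hs : s ∈ R) (hu : u ∈ R) :
    ∑ v, returnProb G d l R i s v * returnProb G d l R i u v ≤ β := by
  have h1 := h s hs
  have h2 := h u hu
  rw [returnNormSq_eq G d hl] at h1 h2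
  have h3 : ∑ v, returnProb G d l R i s v * returnProb G d l R i u v ≤
      ∑ v, (returnProb G d l R i s v ^ 2 / 2 + returnProb G d l R i u v ^ 2 / 2) :=
    Finset.sum_le_sum fun v _ => by
      nlinarith [sq_nonneg (returnProb G d l R i s v - returnProb G d l R i u v)]
  rw [Finset.sum_add_distrib, ← Finset.sum_div, ← Finset.sum_div] at h3
  linarith

/-- A uniform bound on the norms at one scale bounds the probabilities at the next scale. -/
theorem returnProb_succ_le {l : ℕ} (hl : 0 < l) {R : Set (Fin n)} {i : ℕ} {β : ℝ} (hβ : 0 ≤ β)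
    (h : ∀ v ∈ R, returnNormSq G d l R i v ≤ β) {s : Fin n} (hs : s ∈ R) (u : Fin n) :
    returnProb G d l R (i + 1) s u ≤ β := by
  by_cases hu : u ∈ R
  · rw [returnProb_succ_eq_dot G d hl i s hu]
    exact dot_le_of_returnNormSq_le G d hl h hs hu
  · rw [returnProb_of_notMem G d hl _ _ hu]
    exact hβ

/-- Log-convexity of the even moments `⟨e_s, M ^ t e_s⟩` of a symmetric matrix, at
`t = 2, 4, 6` in units of `2 ^ i` steps. The sixth moment is the mean correlation between the
walks of length `2 ^ i l` from the end points of two walks of length `2 ^ (i + 1) l` from `s`. -/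
theorem returnNormSq_sq_le {l : ℕ} (hl : 0 < l) {R : Set (Fin n)} (i : ℕ) (s : Fin n) :
    returnNormSq G d l R (i + 1) s ^ 2 ≤ returnNormSq G d l R i s *
      ∑ a, ∑ b, returnProb G d l R (i + 1) s a *
        (returnProb G d l R (i + 1) s b * returnProb G d l R (i + 1) a b) := by
  set q := returnProb G d l R i with hq
  set q' := returnProb G d l R (i + 1) with hq'
  let v₃ : Fin n → ℝ := fun u => ∑ a, q' s a * q a u
  have e1 : ∑ u, q' s u ^ 2 = ∑ v, q s v * v₃ v := by
    have : ∀ u, q' s u ^ 2 = ∑ v, q' s u * (q s v * q v u) := by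
      intro u
      rw [← Finset.mul_sum, hq', ← returnProb_succ G d hl, sq]
    simp_rw [this, v₃, Finset.mul_sum]
    rw [Finset.sum_comm]
    refine Finset.sum_congr rfl fun v _ => Finset.sum_congr rfl fun u _ => ?_
    by_cases hv : v ∈ R
    · by_cases hu : u ∈ R
      · rw [hq, returnProb_comm G d hl i hv hu]; ring
      · rw [hq', returnProb_of_notMem G d hl _ _ hu]; ring
    · rw [hq, returnProb_of_notMem G d hl i s hv]; ring
  have e2 : ∑ a, ∑ b, q' s a * (q' s b * q' a b) = ∑ u, v₃ u ^ 2 := by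
    have : ∀ a b, q' s a * (q' s b * q' a b) = ∑ u, (q' s a * q a u) * (q' s b * q b u) := by
      intro a b
      by_cases hb : b ∈ R
      · rw [hq', returnProb_succ_eq_dot G d hl i a hb, Finset.mul_sum, Finset.mul_sum]
        exact Finset.sum_congr rfl fun u _ => by ring
      · rw [hq', returnProb_of_notMem G d hl _ s hb]
        simp
    simp_rw [this, v₃, sq, Finset.sum_mul_sum]
    rw [Finset.sum_comm]
    rw [Finset.sum_congr rfl fun b _ => Finset.sum_comm, Finset.sum_comm]
    exact Finset.sum_congr rfl fun u _ => Finset.sum_comm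
  rw [returnNormSq_eq G d hl, returnNormSq_eq G d hl, e2, e1]
  exact Finset.sum_mul_sq_le_sq_mul_sq _ _ _

open Classical in
/-- The indicator that two walks are returning and that the probability of walking from the end
of the one to the end of the other is at least `θ`. -/
noncomputable def correlated {L : ℕ} (l : ℕ) (R : Set (Fin n)) (i : ℕ) (θ : ℝ)
    (v w : Walk n L) : ℝ :=
  if Returning l R v ∧ Returning l R w ∧
    θ ≤ returnProb G d l R (i + 1) (v (Fin.last L)) (w (Fin.last L)) then 1 else 0

theorem correlated_nonneg {L : ℕ} (l : ℕ) (R : Set (Fin n)) (i : ℕ) (θ : ℝ)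
    (v w : Walk n L) : 0 ≤ correlated G d l R i θ v w := by
  unfold correlated; split_ifs <;> norm_num

theorem correlated_le_one {L : ℕ} (l : ℕ) (R : Set (Fin n)) (i : ℕ) (θ : ℝ)
    (v w : Walk n L) : correlated G d l R i θ v w ≤ 1 := by
  unfold correlated; split_ifs <;> norm_num

/-- Two walks from a vertex of large norm have correlated end points with a probability that is
not too small. -/
theorem sq_le_sum_correlated (hd : 0 < d) (hG : ∀ v, G.degree v ≤ d) {l : ℕ} (hl : 0 < l)
    {R : Set (Fin n)} (i : ℕ) {s : Fin n} (hs : s ∈ R) {β γ θ : ℝ} (hγ : 0 ≤ γ) (hθ : 0 ≤ θ)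
    (hβ : ∀ v ∈ R, returnNormSq G d l R i v ≤ β) (hs' : γ ≤ returnNormSq G d l R (i + 1) s) :
    γ ^ 2 ≤ β * (β * (∑ v : Walk n (2 ^ (i + 1) * l), ∑ w : Walk n (2 ^ (i + 1) * l),
      walkProb G d s v * walkProb G d s w * correlated G d l R i θ v w) + θ) := by
  have hβ0 : 0 ≤ β := by
    refine le_trans ?_ (hβ s hs)
    rw [returnNormSq_eq G d hl]
    positivity
  have hw := fun w : Walk n (2 ^ (i + 1) * l) => walkProb_nonneg G d hd hG s w
  have h1 : ∑ a, ∑ b, returnProb G d l R (i + 1) s a *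
        (returnProb G d l R (i + 1) s b * returnProb G d l R (i + 1) a b) =
      ∑ v : Walk n (2 ^ (i + 1) * l), ∑ w : Walk n (2 ^ (i + 1) * l),
        walkProb G d s v * walkProb G d s w * (returnIndicator l R v * returnIndicator l R w *
          returnProb G d l R (i + 1) (v (Fin.last _)) (w (Fin.last _))) := by
    simp_rw [← Finset.mul_sum]
    simp_rw [← sum_walkProb_mul_returnIndicator G d l R (i + 1) s]
    refine Finset.sum_congr rfl fun v _ => ?_
    simp_rw [Finset.mul_sum]
    exact Finset.sum_congr rfl fun w _ => by ring
  have h2 : ∀ v w : Walk n (2 ^ (i + 1) * l), returnIndicator l R v * returnIndicator l R w *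
      returnProb G d l R (i + 1) (v (Fin.last _)) (w (Fin.last _)) ≤
        β * correlated G d l R i θ v w + θ := by
    intro v w
    by_cases hv : Returning l R v
    · by_cases hw : Returning l R w
      · rw [returnIndicator_eq_one hv, returnIndicator_eq_one hw, one_mul, one_mul]
        unfold correlated
        by_cases hθ' : θ ≤ returnProb G d l R (i + 1) (v (Fin.last _)) (w (Fin.last _))
        · rw [if_pos ⟨hv, hw, hθ'⟩, mul_one]
          have := returnProb_succ_le G d hl hβ0 hβ (hv.last_mem hl) (w (Fin.last _))
          linarith
        · rw [if_neg fun h => hθ' h.2.2]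
          linarith [not_le.1 hθ']
      · have := correlated_nonneg G d l R i θ v w
        rw [show returnIndicator l R w = 0 from if_neg hw, mul_zero, zero_mul]
        positivity
    · have := correlated_nonneg G d l R i θ v w
      rw [show returnIndicator l R v = 0 from if_neg hv, zero_mul, zero_mul]
      positivity
  have h3 : ∑ v : Walk n (2 ^ (i + 1) * l), ∑ w : Walk n (2 ^ (i + 1) * l),
        walkProb G d s v * walkProb G d s w * (β * correlated G d l R i θ v w + θ) =
      β * (∑ v : Walk n (2 ^ (i + 1) * l), ∑ w : Walk n (2 ^ (i + 1) * l),
        walkProb G d s v * walkProb G d s w * correlated G d l R i θ v w) + θ := by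
    simp_rw [mul_add, Finset.sum_add_distrib]
    congr 1
    · simp_rw [Finset.mul_sum]
      exact Finset.sum_congr rfl fun v _ => Finset.sum_congr rfl fun w _ => by ring
    · simp_rw [← Finset.sum_mul, ← Finset.mul_sum]
      rw [← Finset.sum_mul, sum_walkProb]
      ring
  calc γ ^ 2 ≤ returnNormSq G d l R (i + 1) s ^ 2 := pow_le_pow_left₀ hγ hs' 2
    _ ≤ _ := returnNormSq_sq_le G d hl i s
    _ ≤ β * (β * (∑ v : Walk n (2 ^ (i + 1) * l), ∑ w : Walk n (2 ^ (i + 1) * l),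
      walkProb G d s v * walkProb G d s w * correlated G d l R i θ v w) + θ) := by
        rw [← h3, h1]
        refine mul_le_mul (hβ s hs) ?_ ?_ hβ0
        · exact Finset.sum_le_sum fun v _ => Finset.sum_le_sum fun w _ =>
            mul_le_mul_of_nonneg_left (h2 v w) (mul_nonneg (hw v) (hw w))
        · exact Finset.sum_nonneg fun v _ => Finset.sum_nonneg fun w _ =>
            mul_nonneg (mul_nonneg (hw v) (hw w)) (mul_nonneg (mul_nonneg
              (returnIndicator_nonneg _ _ _) (returnIndicator_nonneg _ _ _))
              (returnProb_nonneg G d hd hG _ _ _ _ _))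

/-! ### The residues -/

theorem returnNormSq_mono (hd : 0 < d) (hG : ∀ v, G.degree v ≤ d) (l : ℕ) {R R' : Set (Fin n)}
    (h : R ⊆ R') (i : ℕ) (s : Fin n) :
    returnNormSq G d l R i s ≤ returnNormSq G d l R' i s := by
  unfold returnNormSq
  refine Finset.sum_le_sum fun u _ => ?_
  by_cases hu : u ∈ R
  · rw [if_pos hu, if_pos (h hu)]
    exact pow_le_pow_left₀ (returnProb_nonneg G d hd hG l R i s u)
      (returnProb_mono G d hd hG l h i s u) 2
  · rw [if_neg hu]
    split_ifs <;> positivity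

theorem residue_antitone (δ : ℝ) (R₀ : Set (Fin n)) : Antitone (residue G d δ R₀) :=
  antitone_nat_of_succ_le fun _ => Set.sdiff_subset

/-- Vertices that survive phase `j` have small norm at scale `j + 1` ever after. -/
theorem returnNormSq_le_of_mem_residue (hd : 0 < d) (hG : ∀ v, G.degree v ≤ d) (δ : ℝ)
    (R₀ : Set (Fin n)) {i j : ℕ} (hij : j < i) {v : Fin n} (hv : v ∈ residue G d δ R₀ i) :
    returnNormSq G d (baseLength n δ) (residue G d δ R₀ i) (j + 1) v ≤
      1 / (n : ℝ) ^ (δ * j) := by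
  have h1 : v ∈ residue G d δ R₀ (j + 1) := residue_antitone G d δ R₀ hij hv
  have h2 : v ∉ peel G d δ (residue G d δ R₀ j) j := h1.2
  have h3 : ¬ 1 / (n : ℝ) ^ (δ * j) ≤
      returnNormSq G d (baseLength n δ) (residue G d δ R₀ j) (j + 1) v := fun h => h2 ⟨h1.1, h⟩
  exact (returnNormSq_mono G d hd hG _ (residue_antitone G d δ R₀ hij.le) _ _).trans
    (not_le.1 h3).le

end Norms

/-! ### Colliding walks within one call -/

section Calls

variable {n : ℕ} (G : SimpleGraph (Fin n)) [DecidableRel G.Adj] (d : ℕ)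

theorem pathSampleProb_nonneg (hd : 0 < d) (hG : ∀ v, G.degree v ≤ d) {k L : ℕ} (u v : Fin n)
    (c : PathSample n k L) : 0 ≤ pathSampleProb G d u v c :=
  mul_nonneg (Finset.prod_nonneg fun _ _ => walkProb_nonneg G d hd hG _ _)
    (Finset.prod_nonneg fun _ _ => walkProb_nonneg G d hd hG _ _)

theorem sum_pathSampleProb_mul {k L : ℕ} (u v : Fin n) (m m' : Fin k)
    (f : Walk n L → Walk n L → ℝ) :
    ∑ c : PathSample n k L, pathSampleProb G d u v c * f (c.1 m) (c.2 m') =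
      ∑ w, ∑ w', walkProb G d u w * (walkProb G d v w' * f w w') := by
  rw [Fintype.sum_prod_type]
  simp only [pathSampleProb, mul_assoc]
  simp_rw [← Finset.mul_sum]
  have h : ∀ c₁ : Fin k → Walk n L,
      ∑ c₂ : Fin k → Walk n L, (∏ m, walkProb G d v (c₂ m)) * f (c₁ m) (c₂ m') =
        ∑ w', walkProb G d v w' * f (c₁ m) w' := fun c₁ =>
    sum_pi_prod_mul (C := fun _ => Walk n L) (fun _ w => walkProb G d v w)
      (fun _ => sum_walkProb G d v) m' (f (c₁ m))
  simp_rw [h]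
  exact sum_pi_prod_mul (C := fun _ => Walk n L) (fun _ w => walkProb G d u w)
    (fun _ => sum_walkProb G d u) m (fun w => ∑ w', walkProb G d v w' * f w w')

theorem sum_pathSampleProb {k L : ℕ} (u v : Fin n) :
    ∑ c : PathSample n k L, pathSampleProb G d u v c = 1 := by
  rw [Fintype.sum_prod_type]
  simp only [pathSampleProb, ← Finset.mul_sum]
  have h : ∀ u : Fin n, ∑ c : Fin k → Walk n L, ∏ m, walkProb G d u (c m) = 1 := fun u =>
    sum_pi_prod_eq_one (C := fun _ => Walk n L) (fun _ w => walkProb G d u w)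
      fun _ => sum_walkProb G d u
  simp_rw [h, mul_one]
  exact h u

/-- The indicator that the walk is returning and ends at `u`. -/
noncomputable def endsAt {L : ℕ} (l : ℕ) (R : Set (Fin n)) (u : Fin n) (w : Walk n L) : ℝ :=
  returnIndicator l R w * if w (Fin.last L) = u then 1 else 0

open Classical in
/-- The indicator that a call contains a pair of returning walks that end at the same vertex. -/
noncomputable def collides {k L : ℕ} (l : ℕ) (R : Set (Fin n)) (c : PathSample n k L) : ℝ :=
  if ∃ m m' u, endsAt l R u (c.1 m) ≠ 0 ∧ endsAt l R u (c.2 m') ≠ 0 then 1 else 0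

/-- A call at a well correlated pair finds colliding returning walks with probability at least
`1/2`. -/
theorem half_le_sum_collides (hd : 0 < d) (hG : ∀ v, G.degree v ≤ d) {l : ℕ} (hl : 0 < l)
    {R : Set (Fin n)} (i k : ℕ) {u v : Fin n} (hu : u ∈ R) (hv : v ∈ R) {B θ : ℝ}
    (hB : ∀ x ∈ R, ∀ y, returnProb G d l R i x y ≤ B)
    (hθ : θ ≤ returnProb G d l R (i + 1) u v) (h1 : 4 * B ≤ k * θ)
    (h2 : 2 ≤ (k : ℝ) ^ 2 * θ) :
    1 / 2 ≤ ∑ c : PathSample n k (2 ^ i * l), pathSampleProb G d u v c * collides l R c := by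
  rw [returnProb_succ_eq_dot G d hl i u hv] at hθ
  have hE : ∀ x y : Fin n, ∑ w : Walk n (2 ^ i * l), walkProb G d x w * endsAt l R y w =
      returnProb G d l R i x y := by
    intro x y
    unfold endsAt
    rw [sum_walkProb_mul_returnIndicator G d l R i x (fun z => if z = y then 1 else 0)]
    simp
  have hnn : ∀ (y : Fin n) (w : Walk n (2 ^ i * l)), 0 ≤ endsAt l R y w := fun y w =>
    mul_nonneg (returnIndicator_nonneg _ _ _) (by split_ifs <;> norm_num)
  have hφ : ∀ (x y : Fin n) (w : Walk n (2 ^ i * l)), endsAt l R x w * endsAt l R y w =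
      if x = y then endsAt l R x w else 0 := by
    intro x y w
    unfold endsAt returnIndicator
    by_cases hxy : x = y
    · subst hxy
      rw [if_pos rfl]
      split_ifs <;> norm_num
    · rw [if_neg hxy]
      by_cases hx : w (Fin.last _) = x
      · have : w (Fin.last _) ≠ y := fun h => hxy (hx.symm.trans h)
        simp [this]
      · simp [hx]
  have key := half_le_collision k (walkProb G d u) (walkProb G d v) (sum_walkProb G d u)
    (walkProb_nonneg G d hd hG u) (sum_walkProb G d v) (walkProb_nonneg G d hd hG v)
    (endsAt l R) hnn hφ (returnProb G d l R i u) (returnProb G d l R i v) (hE u) (hE v) B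
    (hB u hu) (hB v hv) (h1.trans (mul_le_mul_of_nonneg_left hθ (Nat.cast_nonneg k)))
    (h2.trans (mul_le_mul_of_nonneg_left hθ (sq_nonneg _)))
  refine key.trans_eq (Finset.sum_congr rfl fun c _ => ?_)
  unfold pathSampleProb collides
  by_cases h : ∃ m m' u, endsAt l R u (c.1 m) ≠ 0 ∧ endsAt l R u (c.2 m') ≠ 0
  · rw [if_pos h, if_pos h]
  · rw [if_neg h, if_neg h]

/-- One of the two walks `c.1 m` and `c.2 m'`. -/
def chosenWalk {k L : ℕ} (c : PathSample n k L) (m m' : Fin k) : Bool → Walk n L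
  | false => c.1 m
  | true => c.2 m'

/-- The indicator that the walks `c.1 m` and `c.2 m'` are returning and end at the same vertex,
and that the one selected by `σ` is at `x` at time `t`. -/
noncomputable def collisionAt {k L : ℕ} (l : ℕ) (R : Set (Fin n)) (c : PathSample n k L)
    (σ : Bool) (m m' : Fin k) (t : Fin (L + 1)) (x : Fin n) : ℝ :=
  returnIndicator l R (c.1 m) * returnIndicator l R (c.2 m') *
    ((if c.1 m (Fin.last L) = c.2 m' (Fin.last L) then 1 else 0) *
      if chosenWalk c m m' σ t = x then 1 else 0)

theorem collisionAt_nonneg {k L : ℕ} (l : ℕ) (R : Set (Fin n)) (c : PathSample n k L)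
    (σ : Bool) (m m' : Fin k) (t : Fin (L + 1)) (x : Fin n) :
    0 ≤ collisionAt l R c σ m m' t x :=
  mul_nonneg (mul_nonneg (returnIndicator_nonneg _ _ _) (returnIndicator_nonneg _ _ _))
    (mul_nonneg (by split_ifs <;> norm_num) (by split_ifs <;> norm_num))

theorem sum_walkProb_meet_le (hd : 0 < d) (hG : ∀ v, G.degree v ≤ d) {l : ℕ}
    {R : Set (Fin n)} (i : ℕ) (u : Fin n) {v : Fin n} (hv : v ∈ R) {B : ℝ}
    (hB : ∀ x ∈ R, ∀ y, returnProb G d l R i x y ≤ B) (t : Fin (2 ^ i * l + 1)) (x : Fin n) :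
    ∑ w : Walk n (2 ^ i * l), ∑ w' : Walk n (2 ^ i * l), walkProb G d u w *
      (walkProb G d v w' * (returnIndicator l R w * returnIndicator l R w' *
        ((if w (Fin.last _) = w' (Fin.last _) then 1 else 0) * if w t = x then 1 else 0))) ≤
      B * (stepMatrix G d ^ (t : ℕ)) u x := by
  have h1 : ∀ w : Walk n (2 ^ i * l), ∑ w' : Walk n (2 ^ i * l), walkProb G d u w *
      (walkProb G d v w' * (returnIndicator l R w * returnIndicator l R w' *
        ((if w (Fin.last _) = w' (Fin.last _) then 1 else 0) * if w t = x then 1 else 0))) =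
      walkProb G d u w * ((if w t = x then 1 else 0) * (returnIndicator l R w *
        returnProb G d l R i v (w (Fin.last _)))) := by
    intro w
    have h := sum_walkProb_mul_returnIndicator G d l R i v
      (fun z => if w (Fin.last _) = z then 1 else 0)
    simp only [mul_ite, mul_one, mul_zero, Finset.sum_ite_eq, Finset.mem_univ, if_true] at h
    rw [← h, Finset.mul_sum, Finset.mul_sum, Finset.mul_sum]
    refine Finset.sum_congr rfl fun w' _ => ?_
    split_ifs <;> ring
  simp_rw [h1]
  have h2 : ∀ w : Walk n (2 ^ i * l), walkProb G d u w * ((if w t = x then 1 else 0) *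
      (returnIndicator l R w * returnProb G d l R i v (w (Fin.last _)))) ≤
      B * (walkProb G d u w * if w t = x then 1 else 0) := by
    intro w
    have a1 := walkProb_nonneg G d hd hG u w
    have a2 : returnIndicator l R w * returnProb G d l R i v (w (Fin.last _)) ≤ B :=
      (mul_le_of_le_one_left (returnProb_nonneg G d hd hG _ _ _ _ _)
        (returnIndicator_le_one _ _ _)).trans (hB v hv _)
    split_ifs
    · rw [one_mul, mul_one, mul_comm B]
      exact mul_le_mul_of_nonneg_left a2 a1
    · simp
  refine (Finset.sum_le_sum fun w _ => h2 w).trans ?_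
  rw [← Finset.mul_sum, sum_walkProb_mul G d u t fun y => if y = x then 1 else 0]
  simp

/-- Summing out the partner of the selected walk bounds the probability of a collision by `B`
times the probability that the selected walk is at `x`. -/
theorem sum_collisionAt_le (hd : 0 < d) (hG : ∀ v, G.degree v ≤ d) {l : ℕ}
    {R : Set (Fin n)} (i k : ℕ) {u v : Fin n} (hu : u ∈ R) (hv : v ∈ R) {B : ℝ}
    (hB : ∀ x ∈ R, ∀ y, returnProb G d l R i x y ≤ B) (σ : Bool) (m m' : Fin k)
    (t : Fin (2 ^ i * l + 1)) (x : Fin n) :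
    ∑ c : PathSample n k (2 ^ i * l), pathSampleProb G d u v c * collisionAt l R c σ m m' t x ≤
      B * (stepMatrix G d ^ (t : ℕ)) (cond σ v u) x := by
  cases σ with
  | false =>
    refine le_of_eq_of_le ?_ (sum_walkProb_meet_le G d hd hG i u hv hB t x)
    exact sum_pathSampleProb_mul G d u v m m' fun w w' =>
      returnIndicator l R w * returnIndicator l R w' *
        ((if w (Fin.last _) = w' (Fin.last _) then 1 else 0) * if w t = x then 1 else 0)
  | true =>
    refine le_of_eq_of_le ?_ (sum_walkProb_meet_le G d hd hG i v hu hB t x)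
    refine (sum_pathSampleProb_mul G d u v m m' fun w w' =>
      returnIndicator l R w * returnIndicator l R w' *
        ((if w (Fin.last _) = w' (Fin.last _) then 1 else 0) *
          if w' t = x then 1 else 0)).trans ?_
    rw [Finset.sum_comm]
    refine Finset.sum_congr rfl fun w' _ => Finset.sum_congr rfl fun w _ => ?_
    rw [if_congr (eq_comm (a := w (Fin.last _)) (b := w' (Fin.last _))) rfl rfl]
    ring

/-! ### Unwanted intersections -/

/-- The walk of an iteration that produces the first vertex of the call at position `p`
(`σ = false`), or the second one (`σ = true`). -/
def origin {N : ℕ} (p : Fin N × Fin N) : Bool → Fin N ⊕ Fin N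
  | false => Sum.inl p.1
  | true => Sum.inr p.2

/-- A position of a call, two indices of walks in it, one of these two walks, and a time. -/
abbrev Mark (N k L : ℕ) : Type :=
  (Fin N × Fin N) × Bool × (Fin k × Fin k) × Fin (L + 1)

theorem card_mark (N k L : ℕ) :
    Fintype.card (Mark N k L) = N * N * (2 * (k * k * (L + 1))) := by
  simp [Mark]

/-- The indicator `collisionAt` for a marked walk. -/
noncomputable def Mark.at {N k L : ℕ} (l : ℕ) (R : Set (Fin n))
    (c : Fin N → Fin N → PathSample n k L) (e : Mark N k L) (x : Fin n) : ℝ :=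
  collisionAt l R (c e.1.1 e.1.2) e.2.1 e.2.2.1.1 e.2.2.1.2 e.2.2.2 x

/-- The number of unwanted intersections: of the pairs of marked walks that belong to different
calls, have different origins and meet at the marked times. Only outcomes in which all walks from
`s` are returning are counted. -/
noncomputable def badCount {N k L L' : ℕ} (l : ℕ) (R : Set (Fin n))
    (C : Fin N ⊕ Fin N → Walk n L') (c : Fin N → Fin N → PathSample n k L) : ℝ :=
  (∏ o, returnIndicator l R (C o)) * ∑ e : Mark N k L, ∑ e' : Mark N k L,
    if e.1 ≠ e'.1 ∧ origin e.1 e.2.1 ≠ origin e'.1 e'.2.1 then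
      ∑ x, e.at l R c x * e'.at l R c x else 0

theorem Mark.at_nonneg {N k L : ℕ} (l : ℕ) (R : Set (Fin n))
    (c : Fin N → Fin N → PathSample n k L) (e : Mark N k L) (x : Fin n) : 0 ≤ e.at l R c x :=
  collisionAt_nonneg _ _ _ _ _ _ _ _

theorem badCount_nonneg {N k L L' : ℕ} (l : ℕ) (R : Set (Fin n))
    (C : Fin N ⊕ Fin N → Walk n L') (c : Fin N → Fin N → PathSample n k L) :
    0 ≤ badCount l R C c := by
  refine mul_nonneg (Finset.prod_nonneg fun _ _ => returnIndicator_nonneg _ _ _)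
    (Finset.sum_nonneg fun e _ => Finset.sum_nonneg fun e' _ => ?_)
  split_ifs
  · exact Finset.sum_nonneg fun x _ => mul_nonneg (Mark.at_nonneg _ _ _ _ _)
      (Mark.at_nonneg _ _ _ _ _)
  · exact le_rfl

/-- The weight of the calls of an iteration whose walks from `s` are `C`. -/
noncomputable def callsProb {N k L L' : ℕ} (C : Fin N ⊕ Fin N → Walk n L')
    (c : Fin N → Fin N → PathSample n k L) : ℝ :=
  ∏ a, ∏ b, pathSampleProb G d (C (Sum.inl a) (Fin.last L')) (C (Sum.inr b) (Fin.last L'))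
    (c a b)

theorem sum_callsProb_mark_le (hd : 0 < d) (hG : ∀ v, G.degree v ≤ d) {l : ℕ}
    {R : Set (Fin n)} {N : ℕ} (i k : ℕ) {L' : ℕ} (C : Fin N ⊕ Fin N → Walk n L')
    (hC : ∀ o, C o (Fin.last L') ∈ R) {B : ℝ} (hB0 : 0 ≤ B)
    (hB : ∀ x ∈ R, ∀ y, returnProb G d l R i x y ≤ B) (e e' : Mark N k (2 ^ i * l))
    (he : e.1 ≠ e'.1) (x : Fin n) :
    ∑ c, callsProb G d C c * (e.at l R c x * e'.at l R c x) ≤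
      B ^ 2 * ((stepMatrix G d ^ (e.2.2.2 : ℕ)) (C (origin e.1 e.2.1) (Fin.last L')) x *
        (stepMatrix G d ^ (e'.2.2.2 : ℕ)) (C (origin e'.1 e'.2.1) (Fin.last L')) x) := by
  unfold callsProb Mark.at
  rw [sum_curry_prod_mul_mul (fun a b => pathSampleProb G d (C (Sum.inl a) (Fin.last L'))
    (C (Sum.inr b) (Fin.last L'))) (fun a b => sum_pathSampleProb G d _ _) he
    (fun c => collisionAt l R c e.2.1 e.2.2.1.1 e.2.2.1.2 e.2.2.2 x)
    (fun c => collisionAt l R c e'.2.1 e'.2.2.1.1 e'.2.2.1.2 e'.2.2.2 x)]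
  have key : ∀ e : Mark N k (2 ^ i * l), ∑ c : PathSample n k (2 ^ i * l),
      pathSampleProb G d (C (Sum.inl e.1.1) (Fin.last L')) (C (Sum.inr e.1.2) (Fin.last L')) c *
        collisionAt l R c e.2.1 e.2.2.1.1 e.2.2.1.2 e.2.2.2 x ≤
      B * (stepMatrix G d ^ (e.2.2.2 : ℕ)) (C (origin e.1 e.2.1) (Fin.last L')) x := by
    intro e
    refine (sum_collisionAt_le G d hd hG i k (hC _) (hC _) hB _ _ _ _ _).trans (le_of_eq ?_)
    rcases e with ⟨p, σ, m, t⟩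
    cases σ <;> rfl
  refine (mul_le_mul (key e) (key e') ?_ ?_).trans (le_of_eq (by ring))
  · exact Finset.sum_nonneg fun c _ => mul_nonneg (pathSampleProb_nonneg G d hd hG _ _ _)
      (collisionAt_nonneg _ _ _ _ _ _ _ _)
  · exact mul_nonneg hB0 (stepMatrix_pow_nonneg G d hd hG _ _ _)

/-- Two independent walks from `s`, returning for `2 ^ (i + 1) l` steps, and continued for any
numbers of steps, are at the same vertex with probability at most `β`. -/
theorem sum_meet_le (hd : 0 < d) (hG : ∀ v, G.degree v ≤ d) {l : ℕ} {R : Set (Fin n)} {N : ℕ}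
    (i : ℕ) (s : Fin n) {β : ℝ} (hβ0 : 0 ≤ β) (hβ : ∀ y, returnProb G d l R (i + 1) s y ≤ β)
    {o o' : Fin N ⊕ Fin N} (ho : o ≠ o') (t t' : ℕ) :
    ∑ C : Fin N ⊕ Fin N → Walk n (2 ^ (i + 1) * l), (∏ o, walkProb G d s (C o)) *
      ((∏ o, returnIndicator l R (C o)) * ∑ x, (stepMatrix G d ^ t) (C o (Fin.last _)) x *
        (stepMatrix G d ^ t') (C o' (Fin.last _)) x) ≤ β := by
  set P := stepMatrix G d
  have hP : ∀ t u x, 0 ≤ (P ^ t) u x := stepMatrix_pow_nonneg G d hd hG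
  let μ : ℕ → Fin n → ℝ := fun t x => ∑ u, returnProb G d l R (i + 1) s u * (P ^ t) u x
  have hμβ : ∀ t x, μ t x ≤ β := by
    intro t x
    calc μ t x ≤ ∑ u, β * (P ^ t) u x :=
          Finset.sum_le_sum fun u _ => mul_le_mul_of_nonneg_right (hβ u) (hP t u x)
      _ = β := by rw [← Finset.mul_sum, sum_stepMatrix_pow', mul_one]
  have hμ0 : ∀ t x, 0 ≤ μ t x := fun t x => Finset.sum_nonneg fun u _ =>
    mul_nonneg (returnProb_nonneg G d hd hG _ _ _ _ _) (hP t u x)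
  have hμ1 : ∀ t, ∑ x, μ t x ≤ 1 := by
    intro t
    simp only [μ]
    rw [Finset.sum_comm]
    simp_rw [← Finset.mul_sum, P, sum_stepMatrix_pow, mul_one]
    exact sum_returnProb_le_one G d hd hG l R (i + 1) s
  have hprod : ∀ C : Fin N ⊕ Fin N → Walk n (2 ^ (i + 1) * l),
      ∏ o, returnIndicator l R (C o) ≤ returnIndicator l R (C o) * returnIndicator l R (C o') := by
    intro C
    rw [← Finset.mul_prod_erase _ _ (Finset.mem_univ o),
      ← Finset.mul_prod_erase _ _ (Finset.mem_erase.2 ⟨ho.symm, Finset.mem_univ o'⟩), ← mul_assoc]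
    refine mul_le_of_le_one_right (mul_nonneg (returnIndicator_nonneg _ _ _)
      (returnIndicator_nonneg _ _ _)) (Finset.prod_le_one (fun _ _ => returnIndicator_nonneg _ _ _)
      fun _ _ => returnIndicator_le_one _ _ _)
  calc _ ≤ ∑ C : Fin N ⊕ Fin N → Walk n (2 ^ (i + 1) * l), (∏ o, walkProb G d s (C o)) *
        ∑ x, (returnIndicator l R (C o) * (P ^ t) (C o (Fin.last _)) x) *
          (returnIndicator l R (C o') * (P ^ t') (C o' (Fin.last _)) x) := by
        refine Finset.sum_le_sum fun C _ => mul_le_mul_of_nonneg_left ?_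
          (Finset.prod_nonneg fun _ _ => walkProb_nonneg G d hd hG _ _)
        refine (mul_le_mul_of_nonneg_right (hprod C) (Finset.sum_nonneg fun x _ =>
          mul_nonneg (hP _ _ _) (hP _ _ _))).trans (le_of_eq ?_)
        rw [Finset.mul_sum]
        exact Finset.sum_congr rfl fun x _ => by ring
    _ = ∑ x, μ t x * μ t' x := by
        simp_rw [Finset.mul_sum]
        rw [Finset.sum_comm]
        refine Finset.sum_congr rfl fun x _ => ?_
        rw [sum_pi_prod_mul_mul (fun _ w => walkProb G d s w) (fun _ => sum_walkProb G d s) ho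
          (fun w => returnIndicator l R w * (P ^ t) (w (Fin.last _)) x)
          (fun w => returnIndicator l R w * (P ^ t') (w (Fin.last _)) x),
          sum_walkProb_mul_returnIndicator G d l R (i + 1) s fun u => (P ^ t) u x,
          sum_walkProb_mul_returnIndicator G d l R (i + 1) s fun u => (P ^ t') u x]
    _ ≤ ∑ x, β * μ t' x :=
        Finset.sum_le_sum fun x _ => mul_le_mul_of_nonneg_right (hμβ t x) (hμ0 t' x)
    _ ≤ β := by
        rw [← Finset.mul_sum]
        exact mul_le_of_le_one_right hβ0 (hμ1 t')

/-- The expected number of unwanted intersections. -/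
theorem sum_badCount_le (hd : 0 < d) (hG : ∀ v, G.degree v ≤ d) {l : ℕ} (hl : 0 < l)
    {R : Set (Fin n)} (N i k : ℕ) (s : Fin n) {B β : ℝ} (hB0 : 0 ≤ B)
    (hB : ∀ x ∈ R, ∀ y, returnProb G d l R i x y ≤ B) (hβ0 : 0 ≤ β)
    (hβ : ∀ y, returnProb G d l R (i + 1) s y ≤ β) :
    ∑ C : Fin N ⊕ Fin N → Walk n (2 ^ (i + 1) * l), ∑ c : Fin N → Fin N →
      PathSample n k (2 ^ i * l), (∏ o, walkProb G d s (C o)) * callsProb G d C c *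
        badCount l R C c ≤
      ((N : ℝ) * N * (2 * (k * k * ((2 ^ i * l : ℕ) + 1)))) ^ 2 * (B ^ 2 * β) := by
  set P := stepMatrix G d
  have hP : ∀ t u x, 0 ≤ (P ^ t) u x := stepMatrix_pow_nonneg G d hd hG
  let T : Mark N k (2 ^ i * l) → Mark N k (2 ^ i * l) →
      (Fin N ⊕ Fin N → Walk n (2 ^ (i + 1) * l)) →
      (Fin N → Fin N → PathSample n k (2 ^ i * l)) → ℝ := fun e e' C c =>
    if e.1 ≠ e'.1 ∧ origin e.1 e.2.1 ≠ origin e'.1 e'.2.1 then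
      ∑ x, e.at l R c x * e'.at l R c x else 0
  have hT : ∀ e e', ∑ C, ∑ c, (∏ o, walkProb G d s (C o)) * callsProb G d C c *
      ((∏ o, returnIndicator l R (C o)) * T e e' C c) ≤ B ^ 2 * β := by
    intro e e'
    by_cases h : e.1 ≠ e'.1 ∧ origin e.1 e.2.1 ≠ origin e'.1 e'.2.1
    -- First average over the calls, for fixed walks from `s`, then over the walks from `s`.
    · simp only [T, if_pos h]
      have h1 : ∀ C : Fin N ⊕ Fin N → Walk n (2 ^ (i + 1) * l),
          ∑ c, (∏ o, walkProb G d s (C o)) * callsProb G d C c *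
            ((∏ o, returnIndicator l R (C o)) * ∑ x, e.at l R c x * e'.at l R c x) ≤
          B ^ 2 * ((∏ o, walkProb G d s (C o)) * ((∏ o, returnIndicator l R (C o)) *
            ∑ x, (P ^ (e.2.2.2 : ℕ)) (C (origin e.1 e.2.1) (Fin.last _)) x *
              (P ^ (e'.2.2.2 : ℕ)) (C (origin e'.1 e'.2.1) (Fin.last _)) x)) := by
        intro C
        by_cases hC : ∏ o, returnIndicator l R (C o) = 0
        · simp [hC]
        · have hC' : ∀ o, C o (Fin.last _) ∈ R := fun o =>
            (returning_of_returnIndicator_ne_zero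
              (Finset.prod_ne_zero_iff.1 hC o (Finset.mem_univ o))).last_mem hl
          have h2 : ∑ c, (∏ o, walkProb G d s (C o)) * callsProb G d C c *
              ((∏ o, returnIndicator l R (C o)) * ∑ x, e.at l R c x * e'.at l R c x) =
              (∏ o, walkProb G d s (C o)) * (∏ o, returnIndicator l R (C o)) *
                ∑ x, ∑ c, callsProb G d C c * (e.at l R c x * e'.at l R c x) := by
            rw [Finset.sum_comm (s := (Finset.univ : Finset (Fin n))), Finset.mul_sum]
            refine Finset.sum_congr rfl fun c _ => ?_
            rw [← Finset.mul_sum]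
            ring
          rw [h2]
          refine (mul_le_mul_of_nonneg_left (Finset.sum_le_sum fun x _ =>
            sum_callsProb_mark_le G d hd hG i k C hC' hB0 hB e e' h.1 x)
            (mul_nonneg (Finset.prod_nonneg fun _ _ => walkProb_nonneg G d hd hG _ _)
            (Finset.prod_nonneg fun _ _ => returnIndicator_nonneg _ _ _))).trans (le_of_eq ?_)
          rw [← Finset.mul_sum]
          ring
      refine (Finset.sum_le_sum fun C _ => h1 C).trans ?_
      rw [← Finset.mul_sum]
      exact mul_le_mul_of_nonneg_left (sum_meet_le G d hd hG i s hβ0 hβ h.2 _ _) (sq_nonneg B)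
    · simp only [T, if_neg h, mul_zero, Finset.sum_const_zero]
      positivity
  have h3 : ∑ C : Fin N ⊕ Fin N → Walk n (2 ^ (i + 1) * l), ∑ c : Fin N → Fin N →
      PathSample n k (2 ^ i * l), (∏ o, walkProb G d s (C o)) * callsProb G d C c *
        badCount l R C c =
      ∑ e, ∑ e', ∑ C, ∑ c, (∏ o, walkProb G d s (C o)) * callsProb G d C c *
      ((∏ o, returnIndicator l R (C o)) * T e e' C c) := by
    calc _ = ∑ C, ∑ c, ∑ e, ∑ e', (∏ o, walkProb G d s (C o)) * callsProb G d C c *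
      ((∏ o, returnIndicator l R (C o)) * T e e' C c) := by
          refine Finset.sum_congr rfl fun C _ => Finset.sum_congr rfl fun c _ => ?_
          simp only [badCount, Finset.mul_sum, T]
      _ = ∑ C, ∑ e, ∑ e', ∑ c, (∏ o, walkProb G d s (C o)) * callsProb G d C c *
      ((∏ o, returnIndicator l R (C o)) * T e e' C c) := by
          refine Finset.sum_congr rfl fun C _ => ?_
          rw [Finset.sum_comm]
          exact Finset.sum_congr rfl fun e _ => Finset.sum_comm
      _ = _ := by
          rw [Finset.sum_comm]
          exact Finset.sum_congr rfl fun e _ => Finset.sum_comm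
  rw [h3]
  refine (Finset.sum_le_sum fun e _ => Finset.sum_le_sum fun e' _ => hT e e').trans
    (le_of_eq ?_)
  simp only [Finset.sum_const, Finset.card_univ, card_mark, nsmul_eq_mul]
  push_cast
  ring

end Calls

/-! ### One iteration and the whole run -/

section Iteration

variable {n : ℕ} (G : SimpleGraph (Fin n)) [DecidableRel G.Adj] (d : ℕ)

theorem returning_of_endsAt_ne_zero {L : ℕ} {l : ℕ} {R : Set (Fin n)} {u : Fin n} {w : Walk n L}
    (h : endsAt l R u w ≠ 0) : Returning l R w ∧ w (Fin.last L) = u := by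
  refine ⟨returning_of_returnIndicator_ne_zero (left_ne_zero_of_mul h), ?_⟩
  by_contra hu
  exact right_ne_zero_of_mul h (if_neg hu)

theorem collides_nonneg {k L : ℕ} (l : ℕ) (R : Set (Fin n)) (c : PathSample n k L) :
    0 ≤ collides l R c := by
  unfold collides; split_ifs <;> norm_num

theorem collides_le_one {k L : ℕ} (l : ℕ) (R : Set (Fin n)) (c : PathSample n k L) :
    collides l R c ≤ 1 := by
  unfold collides; split_ifs <;> norm_num

theorem one_le_badCount {N k L L' : ℕ} {l : ℕ} {R : Set (Fin n)}
    {C : Fin N ⊕ Fin N → Walk n L'} (hC : ∀ o, Returning l R (C o))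
    (c : Fin N → Fin N → PathSample n k L) (e e' : Mark N k L) (h1 : e.1 ≠ e'.1)
    (h2 : origin e.1 e.2.1 ≠ origin e'.1 e'.2.1) (x : Fin n) (he : e.at l R c x = 1)
    (he' : e'.at l R c x = 1) : 1 ≤ badCount l R C c := by
  unfold badCount
  rw [Finset.prod_eq_one fun o _ => returnIndicator_eq_one (hC o), one_mul]
  have hnn : ∀ e e' : Mark N k L, 0 ≤ if e.1 ≠ e'.1 ∧ origin e.1 e.2.1 ≠ origin e'.1 e'.2.1 then
      ∑ x, e.at l R c x * e'.at l R c x else 0 := by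
    intro e e'
    split_ifs
    · exact Finset.sum_nonneg fun x _ => mul_nonneg (Mark.at_nonneg _ _ _ _ _)
        (Mark.at_nonneg _ _ _ _ _)
    · exact le_rfl
  refine le_trans ?_ (Finset.single_le_sum (fun e _ => Finset.sum_nonneg fun e' _ => hnn e e')
    (Finset.mem_univ e))
  refine le_trans ?_ (Finset.single_le_sum (fun e' _ => hnn e e') (Finset.mem_univ e'))
  rw [if_pos ⟨h1, h2⟩]
  refine le_trans ?_ (Finset.single_le_sum (fun x _ => mul_nonneg (Mark.at_nonneg l R c e x)
    (Mark.at_nonneg l R c e' x)) (Finset.mem_univ x))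
  rw [he, he', one_mul]

/-- If every call has a collision of returning walks and there is no unwanted intersection, then
the iteration succeeds. -/
theorem success_of_badCount_lt_one {N k L L' : ℕ} (hN : 2 ≤ N) {l : ℕ} {R : Set (Fin n)}
    (x : IterSample n N L' k L) (hA : ∀ a, Returning l R (x.walkA a))
    (hB : ∀ b, Returning l R (x.walkB b)) (hc : ∀ a b, collides l R (x.call a b) ≠ 0)
    (hbad : badCount l R (Sum.elim x.walkA x.walkB) x.call < 1)
    (hstart : ∀ a b m, (x.call a b).1 m 0 = x.vertA a ∧ (x.call a b).2 m 0 = x.vertB b) :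
    x.Success := by
  have hcol : ∀ a b, ∃ m m' u, endsAt l R u ((x.call a b).1 m) ≠ 0 ∧
      endsAt l R u ((x.call a b).2 m') ≠ 0 := by
    intro a b
    by_contra h
    exact hc a b (if_neg h)
  choose m m' u h1 h2 using hcol
  have hC : ∀ o, Returning l R (Sum.elim x.walkA x.walkB o) := by
    rintro (a | b)
    exacts [hA a, hB b]
  have hend : ∀ a b, (x.call a b).1 (m a b) (Fin.last L) = (x.call a b).2 (m' a b) (Fin.last L) :=
    fun a b => (returning_of_endsAt_ne_zero (h1 a b)).2.trans
      (returning_of_endsAt_ne_zero (h2 a b)).2.symm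
  have hdisj : ∀ (p p' : Fin N × Fin N) (σ σ' : Bool) (t t' : Fin (L + 1)), p ≠ p' →
      origin p σ ≠ origin p' σ' →
      chosenWalk (x.call p.1 p.2) (m p.1 p.2) (m' p.1 p.2) σ t ≠
        chosenWalk (x.call p'.1 p'.2) (m p'.1 p'.2) (m' p'.1 p'.2) σ' t' := by
    intro p p' σ σ' t t' hp ho heq
    have hat : ∀ (p : Fin N × Fin N) (σ : Bool) (t : Fin (L + 1)) (y : Fin n),
        chosenWalk (x.call p.1 p.2) (m p.1 p.2) (m' p.1 p.2) σ t = y →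
        Mark.at l R x.call (p, σ, (m p.1 p.2, m' p.1 p.2), t) y = 1 := by
      intro p σ t y hy
      unfold Mark.at collisionAt
      rw [returnIndicator_eq_one (returning_of_endsAt_ne_zero (h1 p.1 p.2)).1,
        returnIndicator_eq_one (returning_of_endsAt_ne_zero (h2 p.1 p.2)).1,
        if_pos (hend p.1 p.2), if_pos hy]
      norm_num
    exact absurd (one_le_badCount hC x.call (p, σ, (m p.1 p.2, m' p.1 p.2), t)
      (p', σ', (m p'.1 p'.2, m' p'.1 p'.2), t') hp ho _ (hat p σ t _ rfl)
      (hat p' σ' t' _ heq.symm)) (not_le.2 hbad)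
  have hret : ∀ a b, ((x.call a b).1 (m a b), (x.call a b).2 (m' a b)) ∈
      returnedPaths (x.call a b) := fun a b => ⟨⟨_, rfl⟩, ⟨_, rfl⟩, hend a b⟩
  have hstep : ∀ w : Walk n L, (∃ a b, ∃ p ∈ returnedPaths (x.call a b), w = p.1 ∨ w = p.2) →
      ∀ t : Fin L, w t.castSucc = w t.succ ∨ x.graph.Adj (w t.castSucc) (w t.succ) := by
    intro w hw t
    by_cases h : w t.castSucc = w t.succ
    · exact Or.inl h
    · refine Or.inr ?_
      unfold IterSample.graph walksGraph
      rw [SimpleGraph.fromRel_adj]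
      exact ⟨h, Or.inl ⟨w, hw, t, rfl, rfl⟩⟩
  refine ⟨fun a b => ⟨_, hret a b⟩, ?_⟩
  refine hasMinor_completeBipartiteGraph x.graph hN x.vertA x.vertB
    (fun a b => (x.call a b).1 (m a b)) (fun a b => (x.call a b).2 (m' a b))
    (fun a b => (hstart a b _).1) (fun a b => (hstart a b _).2) hend
    (fun a b => hstep _ ⟨a, b, _, hret a b, Or.inl rfl⟩)
    (fun a b => hstep _ ⟨a, b, _, hret a b, Or.inr rfl⟩) ?_ ?_ ?_
  · intro a b a' b' t t' h
    exact hdisj (a, b) (a', b') false false t t' (fun e => h (congrArg Prod.fst e))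
      fun e => h (Sum.inl_injective e)
  · intro a b a' b' t t' h
    exact hdisj (a, b) (a', b') true true t t' (fun e => h (congrArg Prod.snd e))
      fun e => h (Sum.inr_injective e)
  · intro a b a' b' t t' h
    exact hdisj (a, b) (a', b') false true t t' h (by simp [origin])

theorem start_eq_of_iterProb_ne_zero {N k L L' : ℕ} {s : Fin n} {x : IterSample n N L' k L}
    (hx : iterProb G d s x ≠ 0) (a b : Fin N) (m : Fin k) :
    (x.call a b).1 m 0 = x.vertA a ∧ (x.call a b).2 m 0 = x.vertB b := by
  have h1 := Finset.prod_ne_zero_iff.1 (Finset.prod_ne_zero_iff.1 (right_ne_zero_of_mul hx) a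
    (Finset.mem_univ a)) b (Finset.mem_univ b)
  have hw : ∀ (u : Fin n) (w : Walk n L), walkProb G d u w ≠ 0 → w 0 = u := by
    intro u w h
    by_contra hu
    exact h (if_neg hu)
  exact ⟨hw _ _ (Finset.prod_ne_zero_iff.1 (left_ne_zero_of_mul h1) m (Finset.mem_univ m)),
    hw _ _ (Finset.prod_ne_zero_iff.1 (right_ne_zero_of_mul h1) m (Finset.mem_univ m))⟩

theorem iterProb_nonneg (hd : 0 < d) (hG : ∀ v, G.degree v ≤ d) {N k L L' : ℕ} (s : Fin n)
    (x : IterSample n N L' k L) : 0 ≤ iterProb G d s x :=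
  mul_nonneg (mul_nonneg (Finset.prod_nonneg fun _ _ => walkProb_nonneg G d hd hG _ _)
    (Finset.prod_nonneg fun _ _ => walkProb_nonneg G d hd hG _ _))
    (Finset.prod_nonneg fun _ _ => Finset.prod_nonneg fun _ _ =>
      pathSampleProb_nonneg G d hd hG _ _ _)

theorem sum_iterProb {N k L L' : ℕ} (s : Fin n) :
    ∑ x : IterSample n N L' k L, iterProb G d s x = 1 := by
  rw [IterSample.sum_eq]
  simp only [iterProb, IterSample.vertA, IterSample.vertB, ← Finset.mul_sum]
  have h1 : ∀ A B : Fin N → Walk n L', ∑ c : Fin N → Fin N → PathSample n k L, ∏ a, ∏ b,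
      pathSampleProb G d (A a (Fin.last L')) (B b (Fin.last L')) (c a b) = 1 := by
    intro A B
    have := sum_curry_prod_mul_prod (fun a b =>
      pathSampleProb (k := k) (L := L) G d (A a (Fin.last L')) (B b (Fin.last L'))) fun _ => 1
    simpa [sum_pathSampleProb] using this
  have h2 : ∑ A : Fin N → Walk n L', ∏ a, walkProb G d s (A a) = 1 :=
    sum_pi_prod_eq_one (C := fun _ => Walk n L') (fun _ w => walkProb G d s w)
      fun _ => sum_walkProb G d s
  simp_rw [h1, mul_one, ← Finset.mul_sum, h2, mul_one]
  exact h2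

/-- The indicator that all end points of the walks from `s` are correlated and that every call
has a collision of returning walks. -/
noncomputable def goodIndicator {N k L L' : ℕ} (l : ℕ) (R : Set (Fin n)) (i : ℕ) (θ : ℝ)
    (x : IterSample n N L' k L) : ℝ :=
  (∏ a, ∏ b, correlated G d l R i θ (x.walkA a) (x.walkB b)) *
    ∏ a, ∏ b, collides l R (x.call a b)

open Classical in
theorem iterProb_mul_goodIndicator_le (hd : 0 < d) (hG : ∀ v, G.degree v ≤ d) {N k L L' : ℕ}
    (hN : 2 ≤ N) (l : ℕ) (R : Set (Fin n)) (i : ℕ) (θ : ℝ) (s : Fin n)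
    (x : IterSample n N L' k L) :
    iterProb G d s x * goodIndicator G d l R i θ x ≤
      (if x.Success then iterProb G d s x else 0) +
        iterProb G d s x * badCount l R (Sum.elim x.walkA x.walkB) x.call := by
  have hp := iterProb_nonneg G d hd hG s x
  have hbad := badCount_nonneg l R (Sum.elim x.walkA x.walkB) x.call
  have hgood : goodIndicator G d l R i θ x ≤ 1 := by
    refine mul_le_one₀ ?_ ?_ ?_
    · exact Finset.prod_le_one (fun _ _ => Finset.prod_nonneg fun _ _ =>
        correlated_nonneg G d _ _ _ _ _ _) fun _ _ => Finset.prod_le_one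
        (fun _ _ => correlated_nonneg G d _ _ _ _ _ _) fun _ _ => correlated_le_one G d _ _ _ _ _ _
    · exact Finset.prod_nonneg fun _ _ => Finset.prod_nonneg fun _ _ => collides_nonneg _ _ _
    · exact Finset.prod_le_one (fun _ _ => Finset.prod_nonneg fun _ _ =>
        collides_nonneg _ _ _) fun _ _ => Finset.prod_le_one
        (fun _ _ => collides_nonneg _ _ _) fun _ _ => collides_le_one _ _ _
  by_cases hs : x.Success
  · rw [if_pos hs]
    nlinarith [mul_le_mul_of_nonneg_left hgood hp, mul_nonneg hp hbad]
  · rw [if_neg hs, zero_add]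
    by_cases hp0 : iterProb G d s x = 0
    · rw [hp0, zero_mul, zero_mul]
    refine mul_le_mul_of_nonneg_left ?_ hp
    by_cases hg0 : goodIndicator G d l R i θ x = 0
    · rw [hg0]; exact hbad
    refine hgood.trans ?_
    by_contra hlt
    refine hs ?_
    have hcorr : ∀ a b, Returning l R (x.walkA a) ∧ Returning l R (x.walkB b) := by
      intro a b
      have := Finset.prod_ne_zero_iff.1 (Finset.prod_ne_zero_iff.1 (left_ne_zero_of_mul hg0) a
        (Finset.mem_univ a)) b (Finset.mem_univ b)
      by_contra h
      exact this (if_neg fun h' => h ⟨h'.1, h'.2.1⟩)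
    exact success_of_badCount_lt_one hN x (fun a => (hcorr a a).1) (fun b => (hcorr b b).2)
      (fun a b => Finset.prod_ne_zero_iff.1 (Finset.prod_ne_zero_iff.1
        (right_ne_zero_of_mul hg0) a (Finset.mem_univ a)) b (Finset.mem_univ b)) (not_le.1 hlt)
      (start_eq_of_iterProb_ne_zero G d hp0)

theorem le_sum_goodIndicator (hd : 0 < d) (hG : ∀ v, G.degree v ≤ d) {l : ℕ} (hl : 0 < l)
    {R : Set (Fin n)} (N i k : ℕ) (s : Fin n) {B θ : ℝ}
    (hB : ∀ x ∈ R, ∀ y, returnProb G d l R i x y ≤ B) (h1 : 4 * B ≤ k * θ)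
    (h2 : 2 ≤ (k : ℝ) ^ 2 * θ) :
    (1 / 2) ^ (N * N) * (∑ v : Walk n (2 ^ (i + 1) * l), ∑ w : Walk n (2 ^ (i + 1) * l),
      walkProb G d s v * walkProb G d s w * correlated G d l R i θ v w) ^ (N * N) ≤
      ∑ x : IterSample n N (2 ^ (i + 1) * l) k (2 ^ i * l),
        iterProb G d s x * goodIndicator G d l R i θ x := by
  refine (mul_le_mul_of_nonneg_left (pow_le_sum_prod_prod N (walkProb G d s)
    (walkProb_nonneg G d hd hG s) (sum_walkProb G d s) _ (correlated_nonneg G d l R i θ))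
    (by positivity)).trans ?_
  rw [IterSample.sum_eq, Finset.mul_sum]
  refine Finset.sum_le_sum fun A _ => ?_
  rw [Finset.mul_sum]
  refine Finset.sum_le_sum fun B' _ => ?_
  have hAB : 0 ≤ (∏ a, walkProb G d s (A a)) * ∏ b, walkProb G d s (B' b) :=
    mul_nonneg (Finset.prod_nonneg fun _ _ => walkProb_nonneg G d hd hG _ _)
      (Finset.prod_nonneg fun _ _ => walkProb_nonneg G d hd hG _ _)
  have e : ∑ c : Fin N → Fin N → PathSample n k (2 ^ i * l), iterProb G d s ⟨A, B', c⟩ *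
      goodIndicator G d l R i θ ⟨A, B', c⟩ =
      (∏ a, walkProb G d s (A a)) * (∏ b, walkProb G d s (B' b)) *
        (∏ a, ∏ b, correlated G d l R i θ (A a) (B' b)) *
        ∏ a, ∏ b, ∑ c : PathSample n k (2 ^ i * l),
          pathSampleProb G d (A a (Fin.last _)) (B' b (Fin.last _)) c * collides l R c := by
    rw [← sum_curry_prod_mul_prod (fun a b =>
      pathSampleProb G d (A a (Fin.last _)) (B' b (Fin.last _))) (collides l R), Finset.mul_sum]
    refine Finset.sum_congr rfl fun c _ => ?_
    simp only [iterProb, goodIndicator, IterSample.vertA, IterSample.vertB]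
    ring
  rw [e, mul_comm ((1 / 2 : ℝ) ^ (N * N))]
  by_cases hc : ∏ a, ∏ b, correlated G d l R i θ (A a) (B' b) = 0
  · rw [hc]; simp
  refine mul_le_mul_of_nonneg_left ?_ (mul_nonneg hAB (Finset.prod_nonneg fun _ _ =>
    Finset.prod_nonneg fun _ _ => correlated_nonneg G d _ _ _ _ _ _))
  have hcorr : ∀ a b, 1 / 2 ≤ ∑ c : PathSample n k (2 ^ i * l),
      pathSampleProb G d (A a (Fin.last _)) (B' b (Fin.last _)) c * collides l R c := by
    intro a b
    have h := Finset.prod_ne_zero_iff.1 (Finset.prod_ne_zero_iff.1 hc a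
      (Finset.mem_univ a)) b (Finset.mem_univ b)
    have h' : Returning l R (A a) ∧ Returning l R (B' b) ∧
        θ ≤ returnProb G d l R (i + 1) (A a (Fin.last _)) (B' b (Fin.last _)) := by
      by_contra h'
      exact h (if_neg h')
    exact half_le_sum_collides G d hd hG hl i k (h'.1.last_mem hl) (h'.2.1.last_mem hl) hB
      h'.2.2 h1 h2
  calc ((1 / 2 : ℝ)) ^ (N * N) = ∏ _a : Fin N, ∏ _b : Fin N, (1 / 2 : ℝ) := by
        simp [pow_mul]
    _ ≤ _ := Finset.prod_le_prod (fun _ _ => by positivity) fun a _ =>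
        Finset.prod_le_prod (fun _ _ => by positivity) fun b _ => hcorr a b

theorem sum_iterProb_mul_badCount {N k L L' : ℕ} (l : ℕ) (R : Set (Fin n)) (s : Fin n) :
    ∑ x : IterSample n N L' k L,
        iterProb G d s x * badCount l R (Sum.elim x.walkA x.walkB) x.call =
      ∑ C : Fin N ⊕ Fin N → Walk n L', ∑ c : Fin N → Fin N → PathSample n k L,
        (∏ o, walkProb G d s (C o)) * callsProb G d C c * badCount l R C c := by
  rw [IterSample.sum_eq, sum_sum_eq_sum_sumElim]
  refine Finset.sum_congr rfl fun C _ => Finset.sum_congr rfl fun c _ => ?_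
  have e : Sum.elim (fun a => C (Sum.inl a)) (fun b => C (Sum.inr b)) = C :=
    Sum.elim_comp_inl_inr C
  rw [Fintype.prod_sum_type]
  simp only [e]
  rfl

open Classical in
/-- A lower bound for the success probability of one iteration: the probability of a good outcome
minus the expected number of unwanted intersections. -/
theorem le_sum_success (hd : 0 < d) (hG : ∀ v, G.degree v ≤ d) {l : ℕ} (hl : 0 < l)
    {R : Set (Fin n)} {N : ℕ} (hN : 2 ≤ N) (i k : ℕ) (s : Fin n) {B β θ : ℝ} (hB0 : 0 ≤ B)
    (hB : ∀ x ∈ R, ∀ y, returnProb G d l R i x y ≤ B) (hβ0 : 0 ≤ β)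
    (hβ : ∀ y, returnProb G d l R (i + 1) s y ≤ β) (h1 : 4 * B ≤ k * θ)
    (h2 : 2 ≤ (k : ℝ) ^ 2 * θ) :
    (1 / 2) ^ (N * N) * (∑ v : Walk n (2 ^ (i + 1) * l), ∑ w : Walk n (2 ^ (i + 1) * l),
      walkProb G d s v * walkProb G d s w * correlated G d l R i θ v w) ^ (N * N) -
      ((N : ℝ) * N * (2 * (k * k * ((2 ^ i * l : ℕ) + 1)))) ^ 2 * (B ^ 2 * β) ≤
      ∑ x : IterSample n N (2 ^ (i + 1) * l) k (2 ^ i * l),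
        if x.Success then iterProb G d s x else 0 := by
  have a1 := le_sum_goodIndicator G d hd hG hl N i k s hB h1 h2
  have a2 := sum_badCount_le G d hd hG hl N i k s hB0 hB hβ0 hβ
  have a3 := Finset.sum_le_sum fun (x : IterSample n N (2 ^ (i + 1) * l) k (2 ^ i * l))
    (_ : x ∈ Finset.univ) => iterProb_mul_goodIndicator_le G d hd hG hN l R i θ s x
  rw [Finset.sum_add_distrib, sum_iterProb_mul_badCount] at a3
  linarith

open Classical in
/-- The iterations are independent, so that the whole run succeeds at least as often as any one of
them. -/
theorem sum_success_le_findBicliqueProb (hd : 0 < d) (hG : ∀ v, G.degree v ≤ d) (r : ℕ) (δ : ℝ)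
    (s : Fin n) {i : ℕ} (hi : i ∈ loopRange r δ) :
    (∑ x : IterSample n (r ^ 2) (2 ^ (i + 1) * baseLength n δ) (numWalks n δ i)
        (2 ^ i * baseLength n δ), if x.Success then iterProb G d s x else 0) ≤
      findBicliqueProb G d r δ s := by
  have h := sum_pi_prod_mul (ι := loopRange r δ)
    (C := fun j => IterSample n (r ^ 2) (2 ^ ((j : ℕ) + 1) * baseLength n δ)
      (numWalks n δ j) (2 ^ (j : ℕ) * baseLength n δ))
    (fun j x => iterProb G d s x) (fun j => sum_iterProb G d s) ⟨i, hi⟩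
    (fun x => if x.Success then 1 else 0)
  simp only [mul_ite, mul_one, mul_zero] at h
  rw [← h]
  unfold findBicliqueProb
  refine Finset.sum_le_sum fun x _ => ?_
  by_cases hx : (x ⟨i, hi⟩).Success
  · rw [if_pos hx, if_pos ⟨_, hx⟩]
    exact le_rfl
  · rw [if_neg hx]
    split_ifs
    · exact Finset.prod_nonneg fun j _ => iterProb_nonneg G d hd hG s _
    · exact le_rfl

end Iteration

/-! ### Choice of parameters -/

/-- The numerical bound behind the theorem: with `ν = n ^ δ`, a good outcome has probability at
least `ν ^ (-3 M)`, and the expected number of unwanted intersections is at most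
`ν ^ (52 - i)`, which is negligible because `5 M ≤ i`. -/
theorem parameter_bound {ν k l p : ℝ} {M i : ℕ} (hM : 53 ≤ M) (hi : 5 * M ≤ i)
    (hν4 : 4 ≤ ν) (hν : ((M : ℝ) * 2 ^ (i + 5)) ^ 2 ≤ ν) (hk0 : 0 ≤ k)
    (hk : k * k ≤ 4 * ν ^ (i + 18)) (hl0 : 0 ≤ l) (hl : l ≤ 2 * ν ^ 5)
    (hp : 1 / (2 * ν ^ 2) ≤ p) :
    1 / ν ^ (4 * M) ≤ (1 / 2) ^ M * p ^ M -
      (M * (2 * (k * k * (2 ^ i * l + 1)))) ^ 2 *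
        ((1 / ν ^ (i - 2)) ^ 2 * (1 / ν ^ (i - 1))) := by
  obtain ⟨j, rfl⟩ : ∃ j, i = j + 2 := ⟨i - 2, by omega⟩
  have hν0 : 0 < ν := by linarith
  have hν1 : 1 ≤ ν := by linarith
  have e1 : j + 2 - 2 = j := by omega
  have e2 : j + 2 - 1 = j + 1 := by omega
  rw [e1, e2]
  have main : 2 / ν ^ (4 * M) ≤ (1 / 2) ^ M * p ^ M := by
    have h1 : ν ^ M / ν ^ (4 * M) = (1 / ν ^ 3) ^ M := by
      rw [div_pow, one_pow, ← pow_mul, div_eq_div_iff (by positivity) (by positivity), one_mul,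
        ← pow_add]
      congr 1; ring
    have h2 : 2 ≤ ν ^ M := by
      calc (2 : ℝ) ≤ ν := by linarith
        _ = ν ^ 1 := (pow_one ν).symm
        _ ≤ ν ^ M := pow_le_pow_right₀ hν1 (by omega)
    calc 2 / ν ^ (4 * M) ≤ ν ^ M / ν ^ (4 * M) := by gcongr
      _ = (1 / ν ^ 3) ^ M := h1
      _ ≤ (1 / 2 * p) ^ M := by
          refine pow_le_pow_left₀ (by positivity) ?_ M
          calc 1 / ν ^ 3 ≤ 1 / (4 * ν ^ 2) := by
                refine one_div_le_one_div_of_le (by positivity) ?_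
                rw [pow_succ ν 2, mul_comm]
                gcongr
            _ = 1 / 2 * (1 / (2 * ν ^ 2)) := by field_simp; norm_num
            _ ≤ 1 / 2 * p := by gcongr
      _ = _ := mul_pow _ _ _
  have bad : (M * (2 * (k * k * (2 ^ (j + 2) * l + 1)))) ^ 2 *
      ((1 / ν ^ j) ^ 2 * (1 / ν ^ (j + 1))) ≤ 1 / ν ^ (4 * M) := by
    have h1 : 2 ^ (j + 2) * l + 1 ≤ 2 ^ (j + 2) * (4 * ν ^ 5) := by
      have a : (1 : ℝ) ≤ 2 ^ (j + 2) * (2 * ν ^ 5) := by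
        have : (1 : ℝ) ≤ 2 ^ (j + 2) := one_le_pow₀ (by norm_num)
        have : (1 : ℝ) ≤ ν ^ 5 := one_le_pow₀ hν1
        nlinarith
      have b : (2 : ℝ) ^ (j + 2) * l ≤ 2 ^ (j + 2) * (2 * ν ^ 5) := by gcongr
      linarith
    have h2 : M * (2 * (k * k * (2 ^ (j + 2) * l + 1))) ≤
        (M * 2 ^ (j + 2 + 5)) * ν ^ (j + 25) := by
      calc M * (2 * (k * k * (2 ^ (j + 2) * l + 1))) ≤
          M * (2 * ((4 * ν ^ (j + 2 + 18)) * (2 ^ (j + 2) * (4 * ν ^ 5)))) := by gcongr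
        _ = _ := by ring
    have h3 : (M * (2 * (k * k * (2 ^ (j + 2) * l + 1)))) ^ 2 ≤ ν * ν ^ (2 * j + 50) := by
      calc _ ≤ ((M * 2 ^ (j + 2 + 5)) * ν ^ (j + 25)) ^ 2 :=
            pow_le_pow_left₀ (by positivity) h2 2
        _ = (M * 2 ^ (j + 2 + 5)) ^ 2 * ν ^ (2 * j + 50) := by ring
        _ ≤ _ := by gcongr
    calc _ ≤ (ν * ν ^ (2 * j + 50)) * ((1 / ν ^ j) ^ 2 * (1 / ν ^ (j + 1))) := by gcongr
      _ = ν ^ 50 / ν ^ j := by field_simp; ring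
      _ ≤ 1 / ν ^ (4 * M) := by
          rw [div_le_div_iff₀ (by positivity) (by positivity), one_mul, ← pow_add]
          exact pow_le_pow_right₀ hν1 (by omega)
  have : 2 / ν ^ (4 * M) = 1 / ν ^ (4 * M) + 1 / ν ^ (4 * M) := by ring
  linarith

/-- The theorem for one `n`, once `n ^ δ` is at least a constant. -/
theorem le_findBicliqueProb {n d r i : ℕ} {δ : ℝ} (hr : 3 ≤ r) (hn : 0 < n)
    (hν8 : 8 ≤ (n : ℝ) ^ δ) (hν : (((r ^ 2 * r ^ 2 : ℕ) : ℝ) * 2 ^ (i + 5)) ^ 2 ≤ (n : ℝ) ^ δ)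
    (hd : 0 < d) (G : SimpleGraph (Fin n)) [DecidableRel G.Adj] (hG : ∀ v, G.degree v ≤ d)
    (R₀ : Set (Fin n)) (hi : 5 * r ^ 4 ≤ i) (hi' : i ∈ loopRange r δ)
    (s : Fin n) (hs : s ∈ stratum G d δ R₀ i) :
    (n : ℝ) ^ (-(4 * δ * (r : ℝ) ^ 4)) ≤ findBicliqueProb G d r δ s := by
  refine le_trans ?_ (sum_success_le_findBicliqueProb G d hd hG r δ s hi')
  have hn0 : (0 : ℝ) ≤ n := Nat.cast_nonneg n
  set ν := (n : ℝ) ^ δ with hνdef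
  have hνpow : ∀ m : ℕ, (n : ℝ) ^ (δ * m) = ν ^ m := fun m => by
    rw [Real.rpow_mul hn0, Real.rpow_natCast]
  have hν0 : 0 < ν := by linarith
  have hν1 : 1 ≤ ν := by linarith
  have hr4 : r ^ 2 * r ^ 2 = r ^ 4 := by ring
  have h81 : 81 ≤ r ^ 4 := by
    calc 81 = 3 ^ 4 := by norm_num
      _ ≤ r ^ 4 := Nat.pow_le_pow_left hr 4
  have hν5 : (n : ℝ) ^ (5 * δ) = ν ^ 5 := by
    rw [mul_comm]; exact_mod_cast hνpow 5
  have hl1 : 0 < baseLength n δ := by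
    unfold baseLength
    rw [hν5]
    exact Nat.ceil_pos.2 (by positivity)
  have hl2 : (baseLength n δ : ℝ) ≤ 2 * ν ^ 5 := by
    unfold baseLength
    rw [hν5]
    have := (Nat.ceil_lt_add_one (a := ν ^ 5) (by positivity)).le
    have : (1 : ℝ) ≤ ν ^ 5 := one_le_pow₀ hν1
    linarith
  set κ := (n : ℝ) ^ (δ * (i + 18) / 2) with hκ
  have hκ2 : κ ^ 2 = ν ^ (i + 18) := by
    rw [hκ, ← Real.rpow_natCast, ← Real.rpow_mul hn0, ← hνpow]
    congr 1
    push_cast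
    ring
  have hκ0 : 0 ≤ κ := Real.rpow_nonneg hn0 _
  have hκ4 : ν ^ 4 ≤ κ := by
    refine (pow_le_pow_iff_left₀ (by positivity) hκ0 two_ne_zero).1 ?_
    rw [hκ2, ← pow_mul]
    exact pow_le_pow_right₀ hν1 (by omega)
  have hκk : κ ≤ numWalks n δ i := Nat.le_ceil _
  have hkκ : (numWalks n δ i : ℝ) ≤ 2 * κ := by
    have h := (Nat.ceil_lt_add_one hκ0).le
    have : (1 : ℝ) ≤ ν ^ 4 := one_le_pow₀ hν1
    change (⌈κ⌉₊ : ℝ) ≤ _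
    linarith
  set k := numWalks n δ i
  set l := baseLength n δ
  set R := residue G d δ R₀ i
  have hsR : s ∈ R := hs.1
  have hsγ : 1 / ν ^ i ≤ returnNormSq G d l R (i + 1) s := by
    rw [← hνpow]; exact hs.2
  -- The norm bounds at scales `i` and `i - 1`.
  have hnorm : ∀ j < i, ∀ v ∈ R, returnNormSq G d l R (j + 1) v ≤ 1 / ν ^ j := by
    intro j hj v hv
    rw [← hνpow]
    exact returnNormSq_le_of_mem_residue G d hd hG δ R₀ hj hv
  have hβ : ∀ v ∈ R, returnNormSq G d l R i v ≤ 1 / ν ^ (i - 1) := by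
    have := hnorm (i - 1) (by omega)
    rwa [Nat.sub_add_cancel (by omega)] at this
  have hB' : ∀ v ∈ R, returnNormSq G d l R (i - 1) v ≤ 1 / ν ^ (i - 2) := by
    have := hnorm (i - 2) (by omega)
    rwa [show i - 2 + 1 = i - 1 by omega] at this
  have hB : ∀ x ∈ R, ∀ y, returnProb G d l R i x y ≤ 1 / ν ^ (i - 2) := by
    intro x hx y
    have := returnProb_succ_le G d hl1 (by positivity) hB' hx y
    rwa [Nat.sub_add_cancel (by omega)] at this
  have hβ' : ∀ y, returnProb G d l R (i + 1) s y ≤ 1 / ν ^ (i - 1) := fun y =>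
    returnProb_succ_le G d hl1 (by positivity) hβ hsR y
  -- The threshold is half the mean correlation, so that pairs below it contribute at most half.
  have hγ := sq_le_sum_correlated G d hd hG hl1 i hsR (θ := 1 / (2 * ν ^ (i + 1)))
    (by positivity : (0 : ℝ) ≤ 1 / ν ^ i) (by positivity) hβ hsγ
  obtain ⟨j, rfl⟩ : ∃ j, i = j + 2 := ⟨i - 2, by omega⟩
  have e1 : j + 2 - 1 = j + 1 := by omega
  have e2 : j + 2 - 2 = j := by omega
  have h1 : 4 * (1 / ν ^ j) ≤ k * (1 / (2 * ν ^ (j + 2 + 1))) := by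
    have a : 4 * (1 / ν ^ j) = 8 * ν ^ 3 * (1 / (2 * ν ^ (j + 2 + 1))) := by
      field_simp
      ring
    rw [a]
    refine mul_le_mul_of_nonneg_right ?_ (by positivity)
    calc 8 * ν ^ 3 ≤ ν * ν ^ 3 := by gcongr
      _ = ν ^ 4 := by ring
      _ ≤ k := hκ4.trans hκk
  have h2 : 2 ≤ (k : ℝ) ^ 2 * (1 / (2 * ν ^ (j + 2 + 1))) := by
    have a : (2 : ℝ) = 4 * ν ^ (j + 2 + 1) * (1 / (2 * ν ^ (j + 2 + 1))) := by
      field_simp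
      norm_num
    refine a.le.trans (mul_le_mul_of_nonneg_right ?_ (by positivity))
    calc 4 * ν ^ (j + 2 + 1) ≤ ν * ν ^ (j + 2 + 1) := by gcongr; linarith
      _ = ν ^ (j + 4) := by ring
      _ ≤ ν ^ (j + 2 + 18) := pow_le_pow_right₀ hν1 (by omega)
      _ = κ ^ 2 := hκ2.symm
      _ ≤ (k : ℝ) ^ 2 := pow_le_pow_left₀ hκ0 hκk 2
  rw [e2] at hB
  have hN : 2 ≤ r ^ 2 := by nlinarith
  refine le_trans ?_ (le_sum_success G d hd hG hl1 hN (j + 2) k s (by positivity) hB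
    (by positivity) hβ' h1 h2)
  set p := ∑ v : Walk n (2 ^ (j + 2 + 1) * l), ∑ w : Walk n (2 ^ (j + 2 + 1) * l),
    walkProb G d s v * walkProb G d s w *
      correlated G d l R (j + 2) (1 / (2 * ν ^ (j + 2 + 1))) v w
  have hp : 1 / (2 * ν ^ 2) ≤ p := by
    rw [e1] at hγ
    have a : (1 / ν ^ (j + 2)) ^ 2 = (1 / ν ^ (j + 1)) ^ 2 * (1 / ν ^ 2) := by
      field_simp
      ring
    have b : 1 / ν ^ (j + 1) * (1 / ν ^ (j + 1) * p + 1 / (2 * ν ^ (j + 2 + 1))) =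
        (1 / ν ^ (j + 1)) ^ 2 * (p + 1 / (2 * ν ^ 2)) := by
      field_simp
      ring
    rw [a, b] at hγ
    have c : 1 / ν ^ 2 ≤ p + 1 / (2 * ν ^ 2) :=
      le_of_mul_le_mul_left hγ (by positivity)
    have e : 1 / ν ^ 2 = 1 / (2 * ν ^ 2) + 1 / (2 * ν ^ 2) := by field_simp; norm_num
    linarith
  have hkk : (k : ℝ) * k ≤ 4 * ν ^ (j + 2 + 18) := by
    rw [← hκ2]
    nlinarith [mul_self_le_mul_self (Nat.cast_nonneg k) hkκ]
  have key := parameter_bound (M := r ^ 2 * r ^ 2) (i := j + 2) (by omega) (by omega)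
    (by linarith) hν (Nat.cast_nonneg k) hkk (Nat.cast_nonneg l) hl2 hp
  have target : (n : ℝ) ^ (-(4 * δ * (r : ℝ) ^ 4)) = 1 / ν ^ (4 * (r ^ 2 * r ^ 2)) := by
    rw [Real.rpow_neg hn0, ← hνpow, one_div]
    congr 2
    push_cast
    ring
  rw [target]
  rw [e2] at key
  push_cast at key ⊢
  exact key

end BicliqueMinor

theorem mainTheorem3 (δ : ℝ) (hδ : 0 < δ) (r : ℕ) (hr : 3 ≤ r) :
    ∃ n₀ : ℕ, ∀ n : ℕ, n₀ ≤ n →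
      ∀ (d : ℕ), 0 < d →
      ∀ (G : SimpleGraph (Fin n)) [DecidableRel G.Adj], (∀ v, G.degree v ≤ d) →
      ∀ (R₀ : Set (Fin n)) (i : ℕ), 5 * r ^ 4 ≤ i → (i : ℝ) ≤ 1 / δ + 3 →
      ∀ s ∈ stratum G d δ R₀ i,
        (n : ℝ) ^ (-(4 * δ * (r : ℝ) ^ 4)) ≤ findBicliqueProb G d r δ s := by
  -- A bound on `i` in terms of `δ` makes the factors `2 ^ i` from the walk lengths constant.
  set K : ℝ := (((r ^ 2 * r ^ 2 : ℕ) : ℝ) * 2 ^ (⌊1 / δ + 3⌋₊ + 5)) ^ 2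
  have h := ((tendsto_rpow_atTop hδ).comp tendsto_natCast_atTop_atTop).eventually_ge_atTop
    (max 8 K)
  obtain ⟨n₀, hn₀⟩ := Filter.eventually_atTop.1 h
  refine ⟨max n₀ 1, fun n hn d hd G _ hG R₀ i hi hi' s hs => ?_⟩
  have hν := hn₀ n ((le_max_left _ _).trans hn)
  simp only [Function.comp_apply] at hν
  have hn1 : 0 < n := (le_max_right _ _).trans hn
  have hiI : i ≤ ⌊1 / δ + 3⌋₊ := Nat.le_floor hi'
  refine le_findBicliqueProb hr hn1 ((le_max_left _ _).trans hν) ?_ hd G hG R₀ hi ?_ s hs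
  · refine le_trans ?_ ((le_max_right _ _).trans hν)
    refine pow_le_pow_left₀ (by positivity) ?_ 2
    gcongr
    norm_num
  · exact Finset.mem_Icc.2 ⟨hi, Nat.le_floor (hi'.trans (by linarith))⟩
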